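/- Let $\mathbb{R}_+=(0,\infty)$ and let $I_\nu$, $K_\nu$ be the modified Bessel functions of the first and second kind. For every $\delta>0$ there is a constant $C>0$, depending only on $\delta$, such that the following holds for all $\nu\ge \tfrac32+\delta$ and all $\beta>0$. Let $K$ be the integral operator $Ku(x)=\int_0^\infty k(x,y)u(y)\,dy$ with kernel $$k(x,y)=\begin{cases}(xy)^{1/2}\,I_\nu(\beta y)\,K_\nu(\beta x), & y\le x,\\ (xy)^{1/2}\,I_\nu(\beta x)\,K_\nu(\beta y), & x\le y,\end{cases}$$ and let $X$ denote multiplication by $x$. Then for $u\in L^2(\mathbb{R}_+)$ (complex-valued) the integral $Ku(x)$ converges absolutely for every $x>0$, and $X^{-2}\circ K$, $(X\partial_x)\circ X^{-2}\circ K$ and $(X\partial_x)^2\circ X^{-2}\circ K$ are bounded operators on $L^2(\mathbb{R}_+)$, where the derivatives are taken in the weak sense on $(0,\infty)$; for $u\in C_0^\infty((0,\infty))$ the function $Ku$ is $C^2$ on $(0,\infty)$ and the derivatives are classical. Moreover $$\|X^{-2}\circ K\|_{L^2\to L^2}\le C\Big(\nu^2-\frac94\Big)^{-1},\qquad \|(X\partial_x)\circ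 X^{-2}\circ K\|_{L^2\to L^2}\le C\Big(\nu-\frac32\Big)^{-1},\qquad \|(X\partial_x)^2\circ X^{-2}\circ K\|_{L^2\to L^2}\le C .$$ -/

import Mathlib

open MeasureTheory Set

noncomputable section

/-- The modified Bessel function of the first kind, by its power series
`I_ν(x) = ∑ₘ (x/2)^(2m+ν) / (m! Γ(m+ν+1))`, for real order `ν` and `x > 0`. -/
def besselI (ν x : ℝ) : ℝ :=
  ∑' m : ℕ, (x / 2) ^ (2 * (m : ℝ) + ν) / ((m.factorial : ℝ) * Real.Gamma ((m : ℝ) + ν + 1))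

/-- The modified Bessel function of the second kind (Macdonald function), by the integral
`K_ν(x) = ∫₀^∞ exp(-x cosh t) cosh(ν t) dt`, for real order `ν` and `x > 0`. -/
def besselK (ν x : ℝ) : ℝ :=
  ∫ t in Ioi (0 : ℝ), Real.exp (-x * Real.cosh t) * Real.cosh (ν * t)

/-- The integral kernel `(xy)^{1/2} I_ν(β min(x,y)) K_ν(β max(x,y))`. -/
def besselKernel (ν β x y : ℝ) : ℝ :=
  if y ≤ x then Real.sqrt (x * y) * (besselI ν (β * y) * besselK ν (β * x))
  else Real.sqrt (x * y) * (besselI ν (β * x) * besselK ν (β * y))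

/-- The integral operator `(K u)(x) = ∫₀^∞ k(x,y) u(y) dy`. -/
def besselOp (ν β : ℝ) (u : ℝ → ℂ) (x : ℝ) : ℂ :=
  ∫ y in Ioi (0 : ℝ), (besselKernel ν β x y : ℂ) * u y

/-- The function `X⁻² K u`, i.e. `x ↦ x⁻² (K u)(x)`. -/
def scaledBesselOp (ν β : ℝ) (u : ℝ → ℂ) (x : ℝ) : ℂ :=
  ((x ^ 2 : ℝ) : ℂ)⁻¹ * besselOp ν β u x

/-- The differential operator `X ∂ₓ` with classical derivative. -/
def eulerOp (f : ℝ → ℂ) (x : ℝ) : ℂ := (x : ℂ) * deriv f x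

/-- Smooth functions with compact support contained in the open half-line `(0,∞)`. -/
structure IsTestFunction (u : ℝ → ℂ) : Prop where
  smooth : ContDiff ℝ (⊤ : ℕ∞) u
  compact : HasCompactSupport u
  support : tsupport u ⊆ Ioi 0

/-- The Hilbert space `L²(0,∞)` of complex-valued functions. -/
abbrev L2Half : Type := Lp ℂ 2 (volume.restrict (Ioi (0 : ℝ)))

theorem IsTestFunction.memLp {u : ℝ → ℂ} (hu : IsTestFunction u) :
    MemLp u 2 (volume.restrict (Ioi (0 : ℝ))) :=
  hu.smooth.continuous.memLp_of_hasCompactSupport hu.compact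

/-- The class in `L²(0,∞)` of a test function. -/
def IsTestFunction.toL2 {u : ℝ → ℂ} (hu : IsTestFunction u) : L2Half :=
  hu.memLp.toLp u

/-- `g = (X ∂ₓ) f` on `(0,∞)` in the weak (distributional) sense:
`∫ f (x φ)' dx = - ∫ g φ dx` for all test functions `φ`. -/
def IsWeakEuler (f g : L2Half) : Prop :=
  ∀ φ : ℝ → ℂ, IsTestFunction φ →
    ∫ x in Ioi (0 : ℝ), f x * deriv (fun t : ℝ => (t : ℂ) * φ t) x
      = - ∫ x in Ioi (0 : ℝ), g x * φ x

end

open Filter Topology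
open scoped ENNReal

/-! ### The entire function underlying `I_ν` -/

/-! Put `φ(x) = √x I_ν(βx)`, `ψ(x) = √x K_ν(βx)` and `V(x) = β² + (ν² - 1/4)/x²`. Both functions
solve `w'' = V w`, and `k` is the Green's function of `-∂² + V` built from them. The estimates use
only the facts recorded in `BesselPair`: positivity, Wronskian `1`, `x φ' ≥ (ν + 1/2) φ` and `x ψ' ≤
-(ν - 1/2) ψ`. They come from first-order relations and three-term recurrences for the functions
`F_s`, `G_s` with `I_s(x) = (x/2)^s F_s(x²/4)` and `K_s(x) = (1/2)(x/2)^(-s) G_s(x²/4)`.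

Combined with the Wronskian, the logarithmic-derivative bounds give `φψ ≤ x/(2ν)` on the diagonal;
integrated, they give power decay off it. Hence `x⁻² k(x,y)` and `x⁻¹ ∂ₓk(x,y)` are dominated,
uniformly in `β`, by multiples of a kernel homogeneous of degree `-1`. Schur's test with weight
`x^(-1/2)` bounds the operators by `(ν² - 1)⁻¹` and `1/(ν+1) + 1/(ν-1)`.

For two derivatives, `(Ku)'' = V Ku - u` reduces `(X∂ₓ)² X⁻² K` to the identity, the two operators
above and `β² K`. The last has norm at most `1` by Schur's test with weight `1`, since `β² ≤ V` and
the integrals of `Vφ = φ''` and `Vψ = ψ''` are explicit. The coefficient `ν² - 1/4` is absorbed by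
the bound `(ν² - 1)⁻¹`. These identities are classical on test functions and pass to weak
derivatives on `L²` by density. -/

/-- The series `F_s(z) = ∑ₘ zᵐ / (m! Γ(m+s+1))`, so that `I_s(x) = (x/2)^s F_s(x²/4)`. -/
noncomputable def besselISeries (s z : ℝ) : ℝ :=
  ∑' m : ℕ, z ^ m / ((m.factorial : ℝ) * Real.Gamma ((m : ℝ) + s + 1))

/-- For `s ≥ 1` the argument lies in `[2,∞)`, where `Γ` increases from `Γ(2) = 1`. The series `F_s`
is therefore dominated by the exponential series. -/
theorem one_le_Gamma_nat_add {s : ℝ} (hs : 1 ≤ s) (m : ℕ) :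
    1 ≤ Real.Gamma ((m : ℝ) + s + 1) := by
  have hm : (0 : ℝ) ≤ m := m.cast_nonneg
  have h := Real.Gamma_strictMonoOn_Ici.monotoneOn (a := 2) (b := (m : ℝ) + s + 1)
    (by simp) (by simp only [mem_Ici]; linarith) (by linarith)
  rwa [Real.Gamma_two] at h

theorem norm_besselISeries_term_le {s : ℝ} (hs : 1 ≤ s) (z : ℝ) (m : ℕ) :
    ‖z ^ m / ((m.factorial : ℝ) * Real.Gamma ((m : ℝ) + s + 1))‖ ≤ |z| ^ m / (m.factorial : ℝ) := by
  have h1 := one_le_Gamma_nat_add hs m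
  have h2 : (0 : ℝ) < m.factorial := by exact_mod_cast m.factorial_pos
  have h3 : 0 < Real.Gamma ((m : ℝ) + s + 1) := one_pos.trans_le h1
  rw [norm_div, norm_pow, Real.norm_eq_abs, Real.norm_eq_abs,
    abs_of_pos (mul_pos h2 h3)]
  exact div_le_div_of_nonneg_left (by positivity) h2 (le_mul_of_one_le_right h2.le h1)

theorem summable_besselISeries {s : ℝ} (hs : 1 ≤ s) (z : ℝ) :
    Summable fun m : ℕ => z ^ m / ((m.factorial : ℝ) * Real.Gamma ((m : ℝ) + s + 1)) :=
  Summable.of_norm_bounded (Real.summable_pow_div_factorial |z|) (norm_besselISeries_term_le hs z)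

/-- Differentiating termwise cancels `m` against `m!`, and the index shift turns `Γ(m+s+1)` into the
Gamma factor of `F_{s+1}`. -/
theorem hasDerivAt_besselISeries {s : ℝ} (hs : 1 ≤ s) (z : ℝ) :
    HasDerivAt (besselISeries s) (besselISeries (s + 1) z) z := by
  let g' : ℕ → ℝ → ℝ := fun m y =>
    (m : ℝ) * y ^ (m - 1) / ((m.factorial : ℝ) * Real.Gamma ((m : ℝ) + s + 1))
  have hsucc : ∀ m y, g' (m + 1) y
      = y ^ m / ((m.factorial : ℝ) * Real.Gamma ((m : ℝ) + (s + 1) + 1)) := by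
    intro m y
    have h1 : ((m + 1 : ℕ) : ℝ) ≠ 0 := by positivity
    simp only [g', Nat.add_sub_cancel, Nat.factorial_succ, Nat.cast_mul, mul_assoc]
    rw [mul_div_mul_left _ _ h1]
    push_cast
    ring_nf
  -- The constant term has derivative zero, so the majorant starts with `0` and continues with the
  -- exponential series at `|z| + 1`, which dominates on the whole ball of that radius.
  let u : ℕ → ℝ := fun m => match m with
    | 0 => 0
    | m + 1 => (|z| + 1) ^ m / (m.factorial : ℝ)
  have hu : Summable u := (summable_nat_add_iff 1).1 (Real.summable_pow_div_factorial (|z| + 1))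
  have key := hasDerivAt_tsum_of_isPreconnected (u := u)
    (g := fun (m : ℕ) (y : ℝ) => y ^ m / ((m.factorial : ℝ) * Real.Gamma ((m : ℝ) + s + 1)))
    (g' := g') (t := Metric.ball (0 : ℝ) (|z| + 1)) (y₀ := z) (y := z) hu Metric.isOpen_ball
    (convex_ball _ _).isPreconnected
    (fun m y _ => (hasDerivAt_pow m y).div_const _)
    (fun m y hy => by
      have hy' : |y| ≤ |z| + 1 := by simpa using (Metric.mem_ball.1 hy).le
      cases m with
      | zero => simp [g', u]
      | succ m =>
        rw [hsucc]
        refine (norm_besselISeries_term_le (by linarith) y m).trans ?_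
        simp only [u]
        gcongr)
    (by simp) (summable_besselISeries hs z) (by simp)
  have hval : ∑' m, g' m z = besselISeries (s + 1) z := by
    have hsum : Summable fun m => g' m z := by
      rw [← summable_nat_add_iff 1]
      simp only [hsucc]
      exact summable_besselISeries (by linarith) z
    rw [hsum.tsum_eq_zero_add]
    simp only [hsucc]
    simp [g', besselISeries]
  rw [← hval]
  exact key

/-- Compare coefficients using `Γ(w+1) = w Γ(w)`. Together with `F_s' = F_{s+1}` this is the
equation `z F'' + (s+1) F' = F`. -/
theorem besselISeries_recurrence {s : ℝ} (hs : 1 ≤ s) (z : ℝ) :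
    z * besselISeries (s + 2) z + (s + 1) * besselISeries (s + 1) z = besselISeries s z := by
  have h2 := (summable_besselISeries (s := s + 2) (by linarith) z).mul_left z
  have h1 := (summable_besselISeries (s := s + 1) (by linarith) z).mul_left (s + 1)
  have h0 := summable_besselISeries hs z
  unfold besselISeries
  rw [← tsum_mul_left, ← tsum_mul_left, h1.tsum_eq_zero_add, h0.tsum_eq_zero_add]
  rw [← summable_nat_add_iff 1] at h1
  rw [add_left_comm, ← h2.tsum_add h1]
  congr 1
  · have hg : Real.Gamma (s + 1 + 1) = (s + 1) * Real.Gamma (s + 1) :=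
      Real.Gamma_add_one (by linarith)
    have := (Real.Gamma_pos_of_pos (show 0 < s + 1 by linarith)).ne'
    simp [hg]
    field_simp
  · congr 1
    ext m
    have hm : (0 : ℝ) ≤ m := m.cast_nonneg
    have e1 : ((m + 1 : ℕ) : ℝ) + (s + 1) + 1 = ((m : ℝ) + s + 2) + 1 := by push_cast; ring
    have e2 : (m : ℝ) + (s + 2) + 1 = ((m : ℝ) + s + 2) + 1 := by ring
    have e3 : ((m + 1 : ℕ) : ℝ) + s + 1 = (m : ℝ) + s + 2 := by push_cast; ring
    rw [e1, e2, e3, Real.Gamma_add_one (by linarith), Nat.factorial_succ]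
    have := (Real.Gamma_pos_of_pos (show 0 < (m : ℝ) + s + 2 by linarith)).ne'
    have : (m.factorial : ℝ) ≠ 0 := by exact_mod_cast m.factorial_ne_zero
    have : (m : ℝ) + s + 2 ≠ 0 := by linarith
    push_cast
    field_simp
    ring

theorem besselISeries_pos {s : ℝ} (hs : 1 ≤ s) {z : ℝ} (hz : 0 ≤ z) : 0 < besselISeries s z := by
  have hΓ := fun m => one_le_Gamma_nat_add hs m
  refine (summable_besselISeries hs z).tsum_pos (fun m => ?_) 0 ?_
  · have := hΓ m
    positivity
  · have := hΓ 0
    simp only [pow_zero]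
    positivity

theorem besselISeries_zero (s : ℝ) : besselISeries s 0 = (Real.Gamma (s + 1))⁻¹ := by
  unfold besselISeries
  rw [tsum_eq_single 0 (fun m hm => by simp [hm])]
  simp

theorem besselI_eq {ν x : ℝ} (hx : 0 < x) :
    besselI ν x = (x / 2) ^ ν * besselISeries ν (x ^ 2 / 4) := by
  unfold besselI besselISeries
  rw [← tsum_mul_left]
  congr 1
  ext m
  rw [Real.rpow_add (by positivity), Real.rpow_mul (by positivity), Real.rpow_natCast,
    show (x / 2) ^ (2 : ℝ) = x ^ 2 / 4 by
      rw [show (2 : ℝ) = ((2 : ℕ) : ℝ) by norm_num, Real.rpow_natCast]; ring]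
  ring

/-! ### The integral transform underlying `K_ν` -/

/-- The function `G_s(z) = ∫₀^∞ exp(-r - z/r) r^(s-1) dr`, so that
`K_s(x) = (1/2) (x/2)^(-s) G_s(x²/4)`. -/
noncomputable def besselKTransform (s z : ℝ) : ℝ :=
  ∫ r in Ioi (0 : ℝ), Real.exp (-r - z / r) * r ^ (s - 1)

theorem measurable_besselKTransform_integrand (s z : ℝ) :
    Measurable fun r : ℝ => Real.exp (-r - z / r) * r ^ (s - 1) := by
  fun_prop

theorem integrableOn_besselKTransform {s z : ℝ} (hs : 0 < s) (hz : 0 ≤ z) :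
    IntegrableOn (fun r : ℝ => Real.exp (-r - z / r) * r ^ (s - 1)) (Ioi 0) := by
  refine (Real.GammaIntegral_convergent hs).mono'
    (measurable_besselKTransform_integrand s z).aestronglyMeasurable ?_
  filter_upwards [ae_restrict_mem measurableSet_Ioi] with r hr
  have hr : 0 < r := hr
  have : 0 ≤ z / r := by positivity
  rw [Real.norm_of_nonneg (by positivity)]
  gcongr
  linarith

/-- Since `exp(-t) ≤ 1/t`, a positive `z` makes up for one power of `r`. -/
theorem besselKTransform_integrand_sub_one_le {s z r : ℝ} (hz : 0 < z) (hr : 0 < r) :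
    Real.exp (-r - z / r) * r ^ (s - 1 - 1) ≤ z⁻¹ * (Real.exp (-r) * r ^ (s - 1)) := by
  have h1 : Real.exp (-(z / r)) ≤ r / z := by
    rw [Real.exp_neg, ← inv_div z r]
    have h : 0 < z / r := by positivity
    exact inv_anti₀ h (by linarith [Real.add_one_le_exp (z / r)])
  rw [sub_eq_add_neg, Real.exp_add, Real.rpow_sub_one hr.ne']
  calc Real.exp (-r) * Real.exp (-(z / r)) * (r ^ (s - 1) / r)
      ≤ Real.exp (-r) * (r / z) * (r ^ (s - 1) / r) := by gcongr
    _ = z⁻¹ * (Real.exp (-r) * r ^ (s - 1)) := by field_simp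

/-- Needed because `G_{ν-2}` enters as a derivative of `G_{ν-1}`, and `ν - 2` may be negative; for
`z > 0` the factor `exp(-z/r)` restores convergence at `r = 0`. -/
theorem integrableOn_besselKTransform_sub_one {s z : ℝ} (hs : 0 < s) (hz : 0 < z) :
    IntegrableOn (fun r : ℝ => Real.exp (-r - z / r) * r ^ (s - 1 - 1)) (Ioi 0) := by
  refine ((Real.GammaIntegral_convergent hs).const_mul z⁻¹).mono'
    (measurable_besselKTransform_integrand (s - 1) z).aestronglyMeasurable ?_
  filter_upwards [ae_restrict_mem measurableSet_Ioi] with r hr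
  have hr : 0 < r := hr
  rw [Real.norm_of_nonneg (by positivity)]
  exact besselKTransform_integrand_sub_one_le hz hr

theorem hasDerivAt_besselKTransform {s z : ℝ} (hs : 0 < s) (hz : 0 < z) :
    HasDerivAt (besselKTransform s) (-besselKTransform (s - 1) z) z := by
  have hz2 : 0 < z / 2 := by positivity
  have key := hasDerivAt_integral_of_dominated_loc_of_deriv_le (μ := volume.restrict (Ioi (0 : ℝ)))
    (F := fun z r : ℝ => Real.exp (-r - z / r) * r ^ (s - 1))
    (F' := fun z r : ℝ => -(Real.exp (-r - z / r) * r ^ (s - 1 - 1)))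
    (bound := fun r : ℝ => (z / 2)⁻¹ * (Real.exp (-r) * r ^ (s - 1)))
    -- Staying above `z/2` makes the factor `y⁻¹` in the dominating function uniform in the
    -- parameter.
    (s := Ioi (z / 2)) (x₀ := z) (Ioi_mem_nhds (by linarith))
    (Eventually.of_forall fun y => (measurable_besselKTransform_integrand s y).aestronglyMeasurable)
    (integrableOn_besselKTransform hs hz.le)
    (measurable_besselKTransform_integrand (s - 1) z).neg.aestronglyMeasurable
    (by
      filter_upwards [ae_restrict_mem measurableSet_Ioi] with r hr y hy
      have hr : 0 < r := hr
      have hy : z / 2 < y := hy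
      rw [norm_neg, Real.norm_of_nonneg (by positivity)]
      refine le_trans ?_ (besselKTransform_integrand_sub_one_le hz2 hr)
      gcongr)
    ((Real.GammaIntegral_convergent hs).const_mul _)
    (by
      filter_upwards [ae_restrict_mem measurableSet_Ioi] with r hr y hy
      have hr : 0 < r := hr
      have h := ((((hasDerivAt_id y).div_const r).const_sub (-r)).exp).mul_const (r ^ (s - 1))
      refine h.congr_deriv ?_
      rw [Real.rpow_sub_one hr.ne' (s - 1)]
      simp only [id]
      ring)
  have h2 := key.2
  rw [integral_neg] at h2
  exact h2

/-- Integrate the derivative of `exp(-r - z/r) r^s` over `(0,∞)`; both boundary terms vanish. -/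
theorem besselKTransform_recurrence {s z : ℝ} (hs : 0 < s) (hz : 0 < z) :
    z * besselKTransform (s - 1) z + s * besselKTransform s z = besselKTransform (s + 1) z := by
  have i1 := integrableOn_besselKTransform_sub_one hs hz
  have i2 := integrableOn_besselKTransform hs hz.le
  have i3 := integrableOn_besselKTransform (s := s + 1) (by linarith) hz.le
  have hbound : ∀ r : ℝ, 0 ≤ r → Real.exp (-r - z / r) * r ^ s ≤ Real.exp (-1 * r) * r ^ s := by
    intro r hr
    have : 0 ≤ z / r := by positivity
    gcongr
    linarith
  have hcont : ContinuousWithinAt (fun r : ℝ => Real.exp (-r - z / r) * r ^ s) (Ici 0) 0 := by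
    have hlim : Tendsto (fun r : ℝ => Real.exp (-1 * r) * r ^ s) (𝓝[Ici 0] 0) (𝓝 0) := by
      have : Continuous fun r : ℝ => Real.exp (-1 * r) * r ^ s :=
        (by fun_prop : Continuous fun r : ℝ => Real.exp (-1 * r)).mul
          (Real.continuous_rpow_const hs.le)
      have h := this.tendsto 0
      simp only [Real.zero_rpow hs.ne', mul_zero] at h
      exact h.mono_left nhdsWithin_le_nhds
    unfold ContinuousWithinAt
    simp only [Real.zero_rpow hs.ne', mul_zero]
    refine squeeze_zero' ?_ ?_ hlim
    · filter_upwards [self_mem_nhdsWithin] with r hr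
      have hr : 0 ≤ r := hr
      positivity
    · filter_upwards [self_mem_nhdsWithin] with r hr using hbound r hr
  have htop : Tendsto (fun r : ℝ => Real.exp (-r - z / r) * r ^ s) atTop (𝓝 0) := by
    have hlim := tendsto_rpow_mul_exp_neg_mul_atTop_nhds_zero s 1 one_pos
    refine squeeze_zero' ?_ ?_ hlim
    · filter_upwards [eventually_ge_atTop 0] with r hr
      positivity
    · filter_upwards [eventually_ge_atTop 0] with r hr
      rw [mul_comm (r ^ s)]
      exact hbound r hr
  have hint : IntegrableOn (fun r : ℝ => z * (Real.exp (-r - z / r) * r ^ (s - 1 - 1))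
      + s * (Real.exp (-r - z / r) * r ^ (s - 1))
      - Real.exp (-r - z / r) * r ^ (s + 1 - 1)) (Ioi 0) :=
    ((i1.const_mul z).add (i2.const_mul s)).sub i3
  have key := integral_Ioi_of_hasDerivAt_of_tendsto hcont (fun r hr => by
    have hr : 0 < r := hr
    have h1 : HasDerivAt (fun r : ℝ => -r - z / r) (-1 - (0 * r - z * 1) / r ^ 2) r :=
      (hasDerivAt_id r).neg.sub ((hasDerivAt_const r z).div (hasDerivAt_id r) hr.ne')
    have h2 := h1.exp.mul (Real.hasDerivAt_rpow_const (p := s) (Or.inl hr.ne'))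
    refine h2.congr_deriv ?_
    rw [Real.rpow_sub_one hr.ne' (s - 1), Real.rpow_sub_one hr.ne' s, add_sub_cancel_right]
    field_simp
    ring) hint htop
  have i12 : IntegrableOn (fun r : ℝ => z * (Real.exp (-r - z / r) * r ^ (s - 1 - 1))
      + s * (Real.exp (-r - z / r) * r ^ (s - 1))) (Ioi 0) :=
    (i1.const_mul z).add (i2.const_mul s)
  rw [integral_sub i12 i3,
    integral_add (i1.const_mul z) (i2.const_mul s), integral_const_mul, integral_const_mul] at key
  simp only [Real.zero_rpow hs.ne', mul_zero, sub_zero] at key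
  unfold besselKTransform
  linarith

theorem tendsto_besselKTransform_zero {s : ℝ} (hs : 0 < s) :
    Tendsto (besselKTransform s) (𝓝[>] 0) (𝓝 (Real.Gamma s)) := by
  rw [Real.Gamma_eq_integral hs]
  refine tendsto_integral_filter_of_dominated_convergence
    (fun r : ℝ => Real.exp (-r) * r ^ (s - 1))
    (Eventually.of_forall fun y => (measurable_besselKTransform_integrand s y).aestronglyMeasurable)
    ?_ (Real.GammaIntegral_convergent hs) ?_
  · filter_upwards [self_mem_nhdsWithin] with z hz
    filter_upwards [ae_restrict_mem measurableSet_Ioi] with r hr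
    have hr : 0 < r := hr
    have hz : 0 < z := hz
    have : 0 ≤ z / r := by positivity
    rw [Real.norm_of_nonneg (by positivity)]
    gcongr
    linarith
  · filter_upwards [ae_restrict_mem measurableSet_Ioi] with r hr
    have : Continuous fun z : ℝ => Real.exp (-r - z / r) * r ^ (s - 1) := by fun_prop
    have h := this.tendsto 0
    simp only [zero_div, sub_zero] at h
    exact h.mono_left nhdsWithin_le_nhds

theorem besselKTransform_pos {s z : ℝ} (hs : 0 < s) (hz : 0 < z) : 0 < besselKTransform s z := by
  unfold besselKTransform
  rw [setIntegral_pos_iff_support_of_nonneg_ae _ (integrableOn_besselKTransform hs hz.le)]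
  · refine lt_of_lt_of_le (by simp : (0 : ENNReal) < volume (Ioi (0 : ℝ))) (measure_mono ?_)
    intro r hr
    have hr' : 0 < r := hr
    exact ⟨by simp only [Function.mem_support]; positivity, hr⟩
  · filter_upwards [ae_restrict_mem measurableSet_Ioi] with r hr
    have hr : 0 < r := hr
    simp only [Pi.zero_apply]
    positivity

/-- The substitution `r = (x/2) eᵗ` turns `-r - x²/(4r)` into `-x cosh t` and yields an integral of
`exp(νt)` over the whole line. Folding it by `t ↦ -t` gives twice the `cosh(νt)` integral on the
half-line. -/
theorem besselK_eq {ν x : ℝ} (hν : 0 < ν) (hx : 0 < x) :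
    besselK ν x = 1 / 2 * ((x / 2) ^ (-ν) * besselKTransform ν (x ^ 2 / 4)) := by
  have hder : ∀ t ∈ (univ : Set ℝ),
      HasDerivWithinAt (fun t : ℝ => x / 2 * Real.exp t) (x / 2 * Real.exp t) univ t :=
    fun t _ => ((Real.hasDerivAt_exp t).const_mul _).hasDerivWithinAt
  have hinj : InjOn (fun t : ℝ => x / 2 * Real.exp t) univ := by
    intro a _ b _ h
    exact Real.exp_injective (mul_left_cancel₀ (by positivity) h)
  have himg : (fun t : ℝ => x / 2 * Real.exp t) '' univ = Ioi 0 := by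
    ext r
    simp only [image_univ, mem_range, mem_Ioi]
    constructor
    · rintro ⟨t, rfl⟩
      positivity
    · intro hr
      refine ⟨Real.log (r / (x / 2)), ?_⟩
      rw [Real.exp_log (by positivity)]
      field_simp
  have hfun : ∀ t : ℝ, |x / 2 * Real.exp t| • (Real.exp (-(x / 2 * Real.exp t)
      - x ^ 2 / 4 / (x / 2 * Real.exp t)) * (x / 2 * Real.exp t) ^ (ν - 1))
      = (x / 2) ^ ν * (Real.exp (-x * Real.cosh t) * Real.exp (ν * t)) := by
    intro t
    have h0 : 0 < x / 2 * Real.exp t := by positivity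
    have h1 : -(x / 2 * Real.exp t) - x ^ 2 / 4 / (x / 2 * Real.exp t) = -x * Real.cosh t := by
      rw [Real.cosh_eq, Real.exp_neg]
      field_simp
      ring
    rw [abs_of_pos h0, smul_eq_mul, h1, Real.rpow_sub_one h0.ne',
      Real.mul_rpow (by positivity) (by positivity), ← Real.exp_mul, mul_comm t ν]
    field_simp
  have hI := (integrableOn_image_iff_integrableOn_abs_deriv_smul MeasurableSet.univ hder hinj
    (fun r : ℝ => Real.exp (-r - x ^ 2 / 4 / r) * r ^ (ν - 1))).1
    (by rw [himg]; exact integrableOn_besselKTransform hν (by positivity))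
  have hE := integral_image_eq_integral_abs_deriv_smul MeasurableSet.univ hder hinj
    (fun r : ℝ => Real.exp (-r - x ^ 2 / 4 / r) * r ^ (ν - 1))
  rw [himg] at hE
  simp only [hfun] at hI hE
  have hc : (x / 2) ^ ν ≠ 0 := (Real.rpow_pos_of_pos (by positivity) _).ne'
  have hI2 : Integrable fun t : ℝ => Real.exp (-x * Real.cosh t) * Real.exp (ν * t) := by
    have := hI.const_mul ((x / 2) ^ ν)⁻¹
    rw [Measure.restrict_univ] at this
    simpa only [inv_mul_cancel_left₀ hc] using this
  have hI3 : Integrable fun t : ℝ => Real.exp (-x * Real.cosh t) * Real.exp (-(ν * t)) := by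
    have := hI2.comp_neg
    simpa only [Real.cosh_neg, mul_neg] using this
  have hsplit : ∫ t, Real.exp (-x * Real.cosh t) * Real.exp (ν * t)
      = 2 * besselK ν x := by
    rw [← intervalIntegral.integral_Iic_add_Ioi (b := 0) hI2.integrableOn hI2.integrableOn]
    have := integral_comp_neg_Ioi 0 (fun t => Real.exp (-x * Real.cosh t) * Real.exp (ν * t))
    simp only [neg_zero, Real.cosh_neg, mul_neg] at this
    rw [← this, ← integral_add hI3.integrableOn hI2.integrableOn]
    unfold besselK
    rw [← integral_const_mul]
    congr 1
    ext t
    rw [Real.cosh_eq (ν * t)]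
    ring
  rw [integral_const_mul, Measure.restrict_univ, hsplit] at hE
  unfold besselKTransform
  rw [hE, Real.rpow_neg (by positivity)]
  field_simp

/-- The Wronskian identity for `I_ν`, `K_ν`, in terms of `F_ν` and `G_ν`. -/
theorem bessel_wronskian {ν z : ℝ} (hν : 1 < ν) (hz : 0 < z) :
    ν * besselISeries ν z * besselKTransform ν z
      + z * (besselISeries (ν + 1) z * besselKTransform ν z
        + besselISeries ν z * besselKTransform (ν - 1) z) = 1 := by
  let P : ℝ → ℝ := fun z => ν * besselISeries ν z * besselKTransform ν z
      + z * (besselISeries (ν + 1) z * besselKTransform ν z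
        + besselISeries ν z * besselKTransform (ν - 1) z)
  -- The expression is constant on `(0,∞)`: after differentiation, the two recurrences cancel
  -- everything.
  have hP : ∀ z ∈ Ioi (0 : ℝ), HasDerivAt P 0 z := by
    intro z hz
    have hz : 0 < z := hz
    have F0 := hasDerivAt_besselISeries hν.le z
    have F1 := hasDerivAt_besselISeries (s := ν + 1) (by linarith) z
    have G0 := hasDerivAt_besselKTransform (s := ν) (by linarith) hz
    have G1 := hasDerivAt_besselKTransform (s := ν - 1) (by linarith) hz
    have rF := besselISeries_recurrence hν.le z
    have rG := besselKTransform_recurrence (s := ν - 1) (by linarith) hz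
    rw [sub_add_cancel] at rG
    rw [add_assoc, one_add_one_eq_two] at F1
    have h := ((F0.const_mul ν).mul G0).add
      ((hasDerivAt_id z).mul ((F1.mul G0).add (F0.mul G1)))
    refine h.congr_deriv ?_
    simp only [id, Pi.mul_apply, Pi.add_apply]
    linear_combination besselKTransform ν z * rF - besselISeries ν z * rG
  have hconst : ∀ w ∈ Ioi (0 : ℝ), P w = P z := fun w hw =>
    isOpen_Ioi.is_const_of_deriv_eq_zero isPreconnected_Ioi
      (fun y hy => (hP y hy).differentiableAt.differentiableWithinAt)
      (fun y hy => (hP y hy).deriv) hw hz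
  -- The constant is read off at `0⁺`. All factors have finite limits there (for `G_{ν-1}` this uses
  -- `ν > 1`), so the term carrying `z` disappears and `ν Γ(ν)/Γ(ν+1) = 1` remains.
  have hlim : Tendsto P (𝓝[>] 0) (𝓝 1) := by
    have c : ∀ s, 1 ≤ s → Tendsto (besselISeries s) (𝓝[>] 0) (𝓝 (besselISeries s 0)) :=
      fun s hs => (hasDerivAt_besselISeries hs 0).continuousAt.tendsto.mono_left nhdsWithin_le_nhds
    have g0 := tendsto_besselKTransform_zero (s := ν) (by linarith)
    have g1 := tendsto_besselKTransform_zero (s := ν - 1) (by linarith)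
    have hid : Tendsto (fun z : ℝ => z) (𝓝[>] 0) (𝓝 0) := nhdsWithin_le_nhds
    have h := (((c ν hν.le).const_mul ν).mul g0).add
      (hid.mul (((c (ν + 1) (by linarith)).mul g0).add ((c ν hν.le).mul g1)))
    convert h using 2
    rw [besselISeries_zero, Real.Gamma_add_one (by linarith)]
    have := (Real.Gamma_pos_of_pos (show 0 < ν by linarith)).ne'
    field_simp
    simp
  have hlim2 : Tendsto P (𝓝[>] 0) (𝓝 (P z)) := by
    refine tendsto_const_nhds.congr' ?_
    filter_upwards [self_mem_nhdsWithin] with w hw using (hconst w hw).symm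
  exact tendsto_nhds_unique hlim2 hlim

/-! ### The fundamental system `√x I_ν(βx)`, `√x K_ν(βx)` -/

/-- The potential of the Bessel operator `-∂ₓ² + β² + (ν² - 1/4)/x²`. -/
noncomputable def besselPotential (ν β x : ℝ) : ℝ := β ^ 2 + (ν ^ 2 - 1 / 4) / x ^ 2

/-- Positive solutions `φ`, `ψ` of `w'' = V w` on `(0,∞)` for the Bessel potential `V`, with
Wronskian `1` and with the logarithmic derivatives of `√x I_ν(βx)` and `√x K_ν(βx)`. -/
structure BesselPair (ν β : ℝ) (φ ψ φ' ψ' : ℝ → ℝ) : Prop where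
  hasDerivAt_left : ∀ x, 0 < x → HasDerivAt φ (φ' x) x
  hasDerivAt_left' : ∀ x, 0 < x → HasDerivAt φ' (besselPotential ν β x * φ x) x
  hasDerivAt_right : ∀ x, 0 < x → HasDerivAt ψ (ψ' x) x
  hasDerivAt_right' : ∀ x, 0 < x → HasDerivAt ψ' (besselPotential ν β x * ψ x) x
  left_pos : ∀ x, 0 < x → 0 < φ x
  right_pos : ∀ x, 0 < x → 0 < ψ x
  left_log : ∀ x, 0 < x → (ν + 1 / 2) * φ x ≤ x * φ' x
  right_log : ∀ x, 0 < x → x * ψ' x ≤ -((ν - 1 / 2) * ψ x)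
  wronskian : ∀ x, 0 < x → φ' x * ψ x - φ x * ψ' x = 1

/-- The profile `c x^(μ+1/2) H(b x²)` shared by `√x I_ν(βx)` and `√x K_ν(βx)`. -/
noncomputable def besselProfile (c μ b : ℝ) (H : ℝ → ℝ) (x : ℝ) : ℝ :=
  c * x ^ (μ + 1 / 2) * H (b * x ^ 2)

/-- The derivative of `besselProfile`, given the derivative `H₁` of `H`. -/
noncomputable def besselProfileDeriv (c μ b : ℝ) (H H₁ : ℝ → ℝ) (x : ℝ) : ℝ :=
  c * x ^ (μ + 1 / 2) * ((μ + 1 / 2) / x * H (b * x ^ 2) + 2 * b * x * H₁ (b * x ^ 2))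

theorem hasDerivAt_besselProfile {c μ b x : ℝ} {H H₁ : ℝ → ℝ} (hx : 0 < x)
    (h : HasDerivAt H (H₁ (b * x ^ 2)) (b * x ^ 2)) :
    HasDerivAt (besselProfile c μ b H) (besselProfileDeriv c μ b H H₁ x) x := by
  have h2 := h.comp x ((hasDerivAt_pow 2 x).const_mul b)
  have h3 := ((Real.hasDerivAt_rpow_const (p := μ + 1 / 2) (Or.inl hx.ne')).const_mul c).mul h2
  refine h3.congr_deriv ?_
  rw [Real.rpow_sub_one hx.ne']
  simp only [besselProfileDeriv, Function.comp]
  push_cast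
  ring

/-- The change of variable `z = b x²` with prefactor `x^(μ+1/2)` transforms `z H'' + (1+μ) H' = H`
into the equation with potential `4b + (μ² - 1/4)/x²`. Since only `μ²` occurs, `μ = ν` and `μ = -ν`
give solutions of the same equation. -/
theorem hasDerivAt_besselProfileDeriv {c μ b x : ℝ} {H H₁ H₂ : ℝ → ℝ} (hx : 0 < x)
    (h : HasDerivAt H (H₁ (b * x ^ 2)) (b * x ^ 2))
    (h₁ : HasDerivAt H₁ (H₂ (b * x ^ 2)) (b * x ^ 2))
    (hode : b * x ^ 2 * H₂ (b * x ^ 2) + (1 + μ) * H₁ (b * x ^ 2) = H (b * x ^ 2)) :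
    HasDerivAt (besselProfileDeriv c μ b H H₁)
      ((4 * b + (μ ^ 2 - 1 / 4) / x ^ 2) * besselProfile c μ b H x) x := by
  have hq := (hasDerivAt_pow 2 x).const_mul b
  have e := h.comp x hq
  have e₁ := h₁.comp x hq
  have hp := (Real.hasDerivAt_rpow_const (p := μ + 1 / 2) (Or.inl hx.ne')).const_mul c
  have h3 := hp.mul ((((hasDerivAt_const x (μ + 1 / 2)).div (hasDerivAt_id x) hx.ne').mul e).add
    (((hasDerivAt_id x).const_mul (2 * b)).mul e₁))
  refine h3.congr_deriv ?_
  rw [Real.rpow_sub_one hx.ne']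
  simp only [besselProfile, Function.comp, id, Pi.mul_apply, Pi.add_apply, Pi.div_apply]
  push_cast
  generalize H (b * x ^ 2) = f at *
  generalize H₁ (b * x ^ 2) = f₁ at *
  generalize H₂ (b * x ^ 2) = f₂ at *
  field_simp
  linear_combination (64 * c * x ^ 2 * b) * hode

theorem exists_besselPair {ν β : ℝ} (hν : 1 < ν) (hβ : 0 < β) :
    ∃ φ ψ φ' ψ' : ℝ → ℝ, BesselPair ν β φ ψ φ' ψ' ∧
      (∀ x, 0 < x → φ x = Real.sqrt x * besselI ν (β * x)) ∧
      (∀ x, 0 < x → ψ x = Real.sqrt x * besselK ν (β * x)) := by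
  have hβ2 : 0 < β / 2 := by positivity
  set b : ℝ := β ^ 2 / 4 with hb
  have hb0 : 0 < b := by positivity
  set c : ℝ := (β / 2) ^ ν with hc
  have hc0 : 0 < c := Real.rpow_pos_of_pos hβ2 _
  have hV : ∀ x, besselPotential ν β x = 4 * b + (ν ^ 2 - 1 / 4) / x ^ 2 := fun x => by
    rw [besselPotential, hb]
    ring
  have hz : ∀ x : ℝ, 0 < x → 0 < b * x ^ 2 := fun x hx => by positivity
  have F0 := fun z => hasDerivAt_besselISeries hν.le z
  have F1 : ∀ z, HasDerivAt (besselISeries (ν + 1)) (besselISeries (ν + 2) z) z := fun z => by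
    have := hasDerivAt_besselISeries (s := ν + 1) (by linarith) z
    rwa [add_assoc, one_add_one_eq_two] at this
  have G0 := fun z (hz : 0 < z) => hasDerivAt_besselKTransform (s := ν) (by linarith) hz
  have G1 : ∀ z, 0 < z → HasDerivAt (fun z => -besselKTransform (ν - 1) z)
      (besselKTransform (ν - 1 - 1) z) z := fun z hz => by
    have := (hasDerivAt_besselKTransform (s := ν - 1) (by linarith) hz).neg
    rwa [neg_neg] at this
  have hpow : ∀ x : ℝ, 0 < x → x ^ (ν + 1 / 2) * x ^ (-ν + 1 / 2) = x := fun x hx => by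
    rw [← Real.rpow_add hx, show ν + 1 / 2 + (-ν + 1 / 2) = 1 by ring, Real.rpow_one]
  refine ⟨besselProfile c ν b (besselISeries ν),
    besselProfile (c⁻¹ / 2) (-ν) b (besselKTransform ν),
    besselProfileDeriv c ν b (besselISeries ν) (besselISeries (ν + 1)),
    besselProfileDeriv (c⁻¹ / 2) (-ν) b (besselKTransform ν)
      (fun z => -besselKTransform (ν - 1) z),
    ⟨fun x hx => hasDerivAt_besselProfile hx (F0 _), fun x hx => ?_,
      fun x hx => hasDerivAt_besselProfile hx (G0 _ (hz x hx)), fun x hx => ?_,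
      fun x hx => ?_, fun x hx => ?_, fun x hx => ?_, fun x hx => ?_, fun x hx => ?_⟩,
    fun x hx => ?_, fun x hx => ?_⟩
  · rw [hV]
    refine hasDerivAt_besselProfileDeriv hx (F0 _) (F1 _) ?_
    rw [← besselISeries_recurrence hν.le (b * x ^ 2)]
    ring
  · rw [hV, ← neg_sq ν]
    refine hasDerivAt_besselProfileDeriv hx (G0 _ (hz x hx)) (G1 _ (hz x hx)) ?_
    have := besselKTransform_recurrence (s := ν - 1) (by linarith) (hz x hx)
    rw [sub_add_cancel] at this
    rw [← this]
    ring
  · have := besselISeries_pos hν.le (hz x hx).le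
    unfold besselProfile
    positivity
  · have := besselKTransform_pos (s := ν) (by linarith) (hz x hx)
    unfold besselProfile
    positivity
  -- The difference `x φ' - (ν + 1/2) φ` is a positive multiple of `F_{ν+1}`; likewise `G_{ν-1} > 0`
  -- yields the bound for `ψ` below.
  · have := besselISeries_pos (s := ν + 1) (by linarith) (hz x hx).le
    have h : 0 ≤ 2 * (c * x ^ (ν + 1 / 2)) * b * x ^ 2 * besselISeries (ν + 1) (b * x ^ 2) := by
      positivity
    unfold besselProfile besselProfileDeriv
    refine sub_nonneg.1 (h.trans_eq ?_)
    field_simp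
    ring
  · have := besselKTransform_pos (s := ν - 1) (by linarith) (hz x hx)
    have h : 0 ≤ 2 * (c⁻¹ / 2 * x ^ (-ν + 1 / 2)) * b * x ^ 2
        * besselKTransform (ν - 1) (b * x ^ 2) := by
      positivity
    unfold besselProfile besselProfileDeriv
    refine sub_nonneg.1 (h.trans_eq ?_)
    field_simp
    ring
  -- The constants `c`, `c⁻¹` cancel, the two powers multiply to `x`, and the `1/2` in `ψ` absorbs
  -- the factor `2`; what is left is the identity for `F_ν`, `G_ν` at `b x²`.
  · have hW := bessel_wronskian hν (hz x hx)
    have hcc : c * c⁻¹ = 1 := mul_inv_cancel₀ hc0.ne'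
    have hx1 := hpow x hx
    have hxi : x * x⁻¹ = 1 := mul_inv_cancel₀ hx.ne'
    simp only [besselProfile, besselProfileDeriv]
    refine Eq.trans ?_ hW
    generalize besselISeries ν (b * x ^ 2) = f at *
    generalize besselISeries (ν + 1) (b * x ^ 2) = f₁ at *
    generalize besselKTransform ν (b * x ^ 2) = g at *
    generalize besselKTransform (ν - 1) (b * x ^ 2) = g₁ at *
    generalize x ^ (ν + 1 / 2) = p at *
    generalize x ^ (-ν + 1 / 2) = q at *
    calc _ = (c * c⁻¹) * (p * q) * (ν * f * g * x⁻¹ + b * x * (f₁ * g + f * g₁)) := by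
          rw [div_eq_mul_inv, div_eq_mul_inv (-ν + 1 / 2)]
          ring
      _ = _ := by
          rw [hcc, hx1]
          linear_combination ν * f * g * hxi
  · rw [besselI_eq (by positivity), Real.sqrt_eq_rpow, besselProfile, Real.rpow_add hx,
      show β * x / 2 = β / 2 * x by ring, Real.mul_rpow hβ2.le hx.le, hb,
      show (β * x) ^ 2 / 4 = β ^ 2 / 4 * x ^ 2 by ring]
    ring
  · rw [besselK_eq (by linarith) (by positivity), Real.sqrt_eq_rpow, besselProfile,
      Real.rpow_add hx, show β * x / 2 = β / 2 * x by ring, Real.mul_rpow hβ2.le hx.le, hb,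
      show (β * x) ^ 2 / 4 = β ^ 2 / 4 * x ^ 2 by ring, hc, Real.rpow_neg hβ2.le]
    ring

/-! ### Schur's test -/

/-- Write `k g = (k w)^(1/2) (k w⁻¹ g²)^(1/2)` and apply Cauchy–Schwarz in `y`. The row bound
controls the first factor; after Tonelli the column bound controls the second. -/
theorem lintegral_schur_le {α : Type*} [MeasurableSpace α] {μ : Measure α} [SFinite μ]
    {k : α → α → ℝ≥0∞} {w g : α → ℝ≥0∞} {A : ℝ≥0∞}
    (hk : AEMeasurable (Function.uncurry k) (μ.prod μ)) (hw : AEMeasurable w μ)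
    (hg : AEMeasurable g μ) (hw0 : ∀ᵐ x ∂μ, w x ≠ 0 ∧ w x ≠ ∞)
    (hrow : ∀ᵐ x ∂μ, ∫⁻ y, k x y * w y ∂μ ≤ A * w x)
    (hcol : ∀ᵐ y ∂μ, ∫⁻ x, k x y * w x ∂μ ≤ A * w y) :
    ∫⁻ x, (∫⁻ y, k x y * g y ∂μ) ^ 2 ∂μ ≤ A ^ 2 * ∫⁻ x, g x ^ 2 ∂μ := by
  have hsec : ∀ᵐ x ∂μ, AEMeasurable (fun y => k x y) μ := by
    filter_upwards [hk.aestronglyMeasurable.prodMk_left] with x hx using hx.aemeasurable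
  have hcs : ∀ᵐ x ∂μ, (∫⁻ y, k x y * g y ∂μ) ^ 2
      ≤ ∫⁻ y, A * (w x * (k x y * ((w y)⁻¹ * g y ^ 2))) ∂μ := by
    filter_upwards [hsec, hrow, hw0] with x hx hr hwx
    have hm1 : AEMeasurable (fun y => (k x y * w y) ^ (1 / 2 : ℝ)) μ := (hx.mul hw).pow_const _
    have hm2 : AEMeasurable (fun y => (k x y * ((w y)⁻¹ * g y ^ 2)) ^ (1 / 2 : ℝ)) μ :=
      (hx.mul (hw.inv.mul (hg.pow_const 2))).pow_const _
    have h := ENNReal.lintegral_mul_le_Lp_mul_Lq μ Real.HolderConjugate.two_two hm1 hm2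
    simp only [Pi.mul_apply, ← ENNReal.rpow_mul] at h
    norm_num at h
    have heq : ∫⁻ y, (k x y * w y) ^ (1 / 2 : ℝ) * (k x y * ((w y)⁻¹ * g y ^ 2)) ^ (1 / 2 : ℝ) ∂μ
        = ∫⁻ y, k x y * g y ∂μ := by
      refine lintegral_congr_ae ?_
      filter_upwards [hw0] with y hy
      rw [← ENNReal.mul_rpow_of_nonneg _ _ (by norm_num),
        show k x y * w y * (k x y * ((w y)⁻¹ * g y ^ 2))
          = (w y * (w y)⁻¹) * (k x y * g y) ^ 2 by ring, ENNReal.mul_inv_cancel hy.1 hy.2, one_mul,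
        ← ENNReal.rpow_natCast, ← ENNReal.rpow_mul]
      norm_num
    rw [heq] at h
    calc (∫⁻ y, k x y * g y ∂μ) ^ 2
        ≤ ((∫⁻ y, k x y * w y ∂μ) ^ (1 / 2 : ℝ)
          * (∫⁻ y, k x y * ((w y)⁻¹ * g y ^ 2) ∂μ) ^ (1 / 2 : ℝ)) ^ 2 := by gcongr
      _ = (∫⁻ y, k x y * w y ∂μ) * ∫⁻ y, k x y * ((w y)⁻¹ * g y ^ 2) ∂μ := by
        rw [mul_pow, ← ENNReal.rpow_natCast, ← ENNReal.rpow_natCast, ← ENNReal.rpow_mul,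
          ← ENNReal.rpow_mul]
        norm_num
      _ ≤ (A * w x) * ∫⁻ y, k x y * ((w y)⁻¹ * g y ^ 2) ∂μ := by gcongr
      _ ≤ ∫⁻ y, A * w x * (k x y * ((w y)⁻¹ * g y ^ 2)) ∂μ := lintegral_const_mul_le _ _
      _ = _ := by simp only [mul_assoc]
  have hmeas : AEMeasurable (Function.uncurry fun x y =>
      A * (w x * (k x y * ((w y)⁻¹ * g y ^ 2)))) (μ.prod μ) := by
    have h1 : AEMeasurable (fun z : α × α => w z.1) (μ.prod μ) := hw.comp_fst
    have h2 : AEMeasurable (fun z : α × α => w z.2) (μ.prod μ) := hw.comp_snd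
    have h3 : AEMeasurable (fun z : α × α => g z.2) (μ.prod μ) := hg.comp_snd
    exact (h1.mul (hk.mul (h2.inv.mul (h3.pow_const 2)))).const_mul A
  have hsec' : ∀ᵐ y ∂μ, AEMeasurable (fun x => k x y) μ := by
    filter_upwards [hk.aestronglyMeasurable.prodMk_right] with y hy using hy.aemeasurable
  calc ∫⁻ x, (∫⁻ y, k x y * g y ∂μ) ^ 2 ∂μ
      ≤ ∫⁻ x, ∫⁻ y, A * (w x * (k x y * ((w y)⁻¹ * g y ^ 2))) ∂μ ∂μ := lintegral_mono_ae hcs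
    _ = ∫⁻ y, ∫⁻ x, A * (w x * (k x y * ((w y)⁻¹ * g y ^ 2))) ∂μ ∂μ :=
      lintegral_lintegral_swap hmeas
    _ ≤ ∫⁻ y, A ^ 2 * g y ^ 2 ∂μ := by
      refine lintegral_mono_ae ?_
      filter_upwards [hcol, hw0, hsec'] with y hc hwy hy
      calc ∫⁻ x, A * (w x * (k x y * ((w y)⁻¹ * g y ^ 2))) ∂μ
          = ∫⁻ x, (k x y * w x) * (A * ((w y)⁻¹ * g y ^ 2)) ∂μ := by
            congr 1
            ext x
            ring
        _ = (∫⁻ x, k x y * w x ∂μ) * (A * ((w y)⁻¹ * g y ^ 2)) :=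
            lintegral_mul_const'' _ (hy.mul hw)
        _ ≤ (A * w y) * (A * ((w y)⁻¹ * g y ^ 2)) := by gcongr
        _ = (w y * (w y)⁻¹) * (A ^ 2 * g y ^ 2) := by ring
        _ = A ^ 2 * g y ^ 2 := by rw [ENNReal.mul_inv_cancel hwy.1 hwy.2, one_mul]
    _ = A ^ 2 * ∫⁻ x, g x ^ 2 ∂μ := lintegral_const_mul'' _ (hg.pow_const 2)

/-- Schur's bound applied to absolute values also makes the defining integral converge for almost
every `x`, which is what additivity of the operator requires. -/
theorem exists_clm_of_schur {α : Type*} [MeasurableSpace α] {μ : Measure α} [SFinite μ]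
    {κ : α → α → ℝ} {w : α → ℝ≥0∞} {A : ℝ} (hA : 0 ≤ A)
    (hκ : AEStronglyMeasurable (Function.uncurry κ) (μ.prod μ)) (hw : AEMeasurable w μ)
    (hw0 : ∀ᵐ x ∂μ, w x ≠ 0 ∧ w x ≠ ∞)
    (hrow : ∀ᵐ x ∂μ, ∫⁻ y, ‖κ x y‖ₑ * w y ∂μ ≤ ENNReal.ofReal A * w x)
    (hcol : ∀ᵐ y ∂μ, ∫⁻ x, ‖κ x y‖ₑ * w x ∂μ ≤ ENNReal.ofReal A * w y) :
    ∃ T : Lp ℂ 2 μ →L[ℂ] Lp ℂ 2 μ, ‖T‖ ≤ A ∧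
      ∀ u : Lp ℂ 2 μ, T u =ᵐ[μ] fun x => ∫ y, (κ x y : ℂ) * u y ∂μ := by
  have hsq : ∀ u : α → ℂ, eLpNorm u 2 μ = (∫⁻ x, ‖u x‖ₑ ^ 2 ∂μ) ^ (1 / 2 : ℝ) := fun u => by
    rw [eLpNorm_eq_lintegral_rpow_enorm_toReal (by norm_num) (by norm_num)]
    norm_num
  have hκC : AEStronglyMeasurable (fun z : α × α => (κ z.1 z.2 : ℂ)) (μ.prod μ) :=
    Complex.continuous_ofReal.comp_aestronglyMeasurable hκ
  have hmeas : ∀ u : Lp ℂ 2 μ,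
      AEStronglyMeasurable (fun z : α × α => (κ z.1 z.2 : ℂ) * u z.2) (μ.prod μ) :=
    fun u => hκC.mul (Lp.aestronglyMeasurable u).comp_snd
  have hmain : ∀ u : Lp ℂ 2 μ,
      ∫⁻ x, (∫⁻ y, ‖(κ x y : ℂ) * u y‖ₑ ∂μ) ^ 2 ∂μ
        ≤ ENNReal.ofReal A ^ 2 * ∫⁻ x, ‖u x‖ₑ ^ 2 ∂μ := fun u => by
    simp only [enorm_mul]
    have he : ∀ r : ℝ, ‖(r : ℂ)‖ₑ = ‖r‖ₑ := fun r => by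
      rw [← ofReal_norm, ← ofReal_norm, Complex.norm_real]
    simp only [he]
    exact lintegral_schur_le hκ.enorm hw (Lp.aestronglyMeasurable u).enorm hw0 hrow hcol
  have hfin : ∀ u : Lp ℂ 2 μ, ∫⁻ x, ‖u x‖ₑ ^ 2 ∂μ ≠ ∞ := fun u h => by
    have := Lp.eLpNorm_ne_top u
    rw [hsq, h] at this
    norm_num at this
  have hint : ∀ u : Lp ℂ 2 μ, ∀ᵐ x ∂μ, Integrable (fun y => (κ x y : ℂ) * u y) μ := fun u => by
    have h1 := ae_lt_top' ((hmeas u).enorm.lintegral_prod_right'.pow_const 2)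
      ((hmain u).trans_lt (ENNReal.mul_lt_top (by simp) (hfin u).lt_top)).ne
    filter_upwards [h1, (hmeas u).prodMk_left] with x hx hx2
    refine ⟨hx2, ?_⟩
    rw [hasFiniteIntegral_iff_enorm]
    by_contra h
    rw [not_lt, top_le_iff] at h
    rw [h] at hx
    simp at hx
  have hnorm : ∀ u : Lp ℂ 2 μ, eLpNorm (fun x => ∫ y, (κ x y : ℂ) * u y ∂μ) 2 μ
      ≤ ENNReal.ofReal A * eLpNorm u 2 μ := fun u => by
    rw [hsq, hsq]
    calc (∫⁻ x, ‖∫ y, (κ x y : ℂ) * u y ∂μ‖ₑ ^ 2 ∂μ) ^ (1 / 2 : ℝ)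
        ≤ (ENNReal.ofReal A ^ 2 * ∫⁻ x, ‖u x‖ₑ ^ 2 ∂μ) ^ (1 / 2 : ℝ) := by
          refine ENNReal.rpow_le_rpow (le_trans ?_ (hmain u)) (by norm_num)
          gcongr with x
          exact enorm_integral_le_lintegral_enorm _
      _ = _ := by
          rw [ENNReal.mul_rpow_of_nonneg _ _ (by norm_num), ← ENNReal.rpow_natCast,
            ← ENNReal.rpow_mul]
          norm_num
  have hmem : ∀ u : Lp ℂ 2 μ, MemLp (fun x => ∫ y, (κ x y : ℂ) * u y ∂μ) 2 μ := fun u =>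
    ⟨(hmeas u).integral_prod_right', (hnorm u).trans_lt
      (ENNReal.mul_lt_top (by simp) (Lp.eLpNorm_ne_top u).lt_top)⟩
  let T₀ : Lp ℂ 2 μ →ₗ[ℂ] Lp ℂ 2 μ :=
    { toFun := fun u => (hmem u).toLp _
      map_add' := fun u v => by
        rw [← MemLp.toLp_add]
        refine MemLp.toLp_congr _ _ ?_
        filter_upwards [hint u, hint v] with x hu hv
        rw [Pi.add_apply, ← integral_add hu hv]
        refine integral_congr_ae ?_
        filter_upwards [Lp.coeFn_add u v] with y hy
        rw [hy, Pi.add_apply, mul_add]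
      map_smul' := fun c u => by
        rw [RingHom.id_apply, ← MemLp.toLp_const_smul]
        refine MemLp.toLp_congr _ _ (Eventually.of_forall fun x => ?_)
        simp only [Pi.smul_apply]
        rw [← integral_smul]
        refine integral_congr_ae ?_
        filter_upwards [Lp.coeFn_smul c u] with y hy
        rw [hy, Pi.smul_apply, smul_eq_mul, smul_eq_mul]
        ring }
  have hbound : ∀ u, ‖T₀ u‖ ≤ A * ‖u‖ := fun u => by
    change ‖(hmem u).toLp _‖ ≤ _
    rw [Lp.norm_toLp, Lp.norm_def]
    have h := ENNReal.toReal_mono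
      (ENNReal.mul_lt_top (by simp) (Lp.eLpNorm_ne_top u).lt_top).ne (hnorm u)
    rwa [ENNReal.toReal_mul, ENNReal.toReal_ofReal hA] at h
  exact ⟨T₀.mkContinuous A hbound, T₀.mkContinuous_norm_le hA hbound,
    fun u => (hmem u).coeFn_toLp⟩

/-! ### Kernel bounds -/

/-- The kernel equal to `p(x) φ(y)` for `y ≤ x` and to `q(x) ψ(y)` for `x < y`. -/
noncomputable def greenKernel (φ ψ p q : ℝ → ℝ) (x y : ℝ) : ℝ :=
  if y ≤ x then p x * φ y else q x * ψ y

/-- The homogeneous kernel `(y/x)^(ν+1/2)` for `y ≤ x`, `(x/y)^(ν-1/2)` for `x < y`. -/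
noncomputable def powerKernel (ν x y : ℝ) : ℝ :=
  if y ≤ x then (y / x) ^ (ν + 1 / 2) else (x / y) ^ (ν - 1 / 2)

theorem powerKernel_nonneg {ν x y : ℝ} (hx : 0 < x) (hy : 0 < y) : 0 ≤ powerKernel ν x y := by
  unfold powerKernel
  split_ifs <;> positivity

theorem aestronglyMeasurable_greenKernel {μ : Measure ℝ} [SFinite μ] {φ ψ p q : ℝ → ℝ}
    (hφ : AEStronglyMeasurable φ μ) (hψ : AEStronglyMeasurable ψ μ)
    (hp : AEStronglyMeasurable p μ) (hq : AEStronglyMeasurable q μ) :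
    AEStronglyMeasurable (Function.uncurry (greenKernel φ ψ p q)) (μ.prod μ) := by
  classical
  have hs : MeasurableSet {z : ℝ × ℝ | z.2 ≤ z.1} := measurableSet_le measurable_snd measurable_fst
  have h := AEStronglyMeasurable.piecewise (μ := μ.prod μ) hs
    (f := fun z : ℝ × ℝ => p z.1 * φ z.2) (g := fun z : ℝ × ℝ => q z.1 * ψ z.2)
    ((hp.comp_fst.mul hφ.comp_snd).restrict) ((hq.comp_fst.mul hψ.comp_snd).restrict)
  refine h.congr (Eventually.of_forall fun z => ?_)
  simp only [Set.piecewise, mem_ofPred_eq, Function.uncurry_def, greenKernel]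

theorem ContinuousOn.aestronglyMeasurable_Ioi {f : ℝ → ℝ} (hf : ContinuousOn f (Ioi 0)) :
    AEStronglyMeasurable f (volume.restrict (Ioi 0)) :=
  hf.aestronglyMeasurable measurableSet_Ioi

theorem setLIntegral_Ioi_eq_add {f : ℝ → ℝ≥0∞} {c : ℝ} (hc : 0 < c) :
    ∫⁻ y in Ioi 0, f y = (∫⁻ y in Ioc 0 c, f y) + ∫⁻ y in Ioi c, f y := by
  rw [← Ioc_union_Ioi_eq_Ioi hc.le, lintegral_union measurableSet_Ioi]
  exact Set.disjoint_left.2 fun y hy hy' => not_lt.2 hy.2 hy'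

/-- All integrals of `powerKernel` below have this shape: one power up to the diagonal, another
beyond it. -/
theorem setLIntegral_Ioi_rpow_split {f : ℝ → ℝ≥0∞} {a b c s t : ℝ} (ha : 0 ≤ a) (hb : 0 ≤ b)
    (hc : 0 < c) (hs : -1 < s) (ht : t < -1)
    (h₁ : ∀ y ∈ Ioc 0 c, f y = ENNReal.ofReal (a * y ^ s))
    (h₂ : ∀ y ∈ Ioi c, f y = ENNReal.ofReal (b * y ^ t)) :
    ∫⁻ y in Ioi 0, f y
      = ENNReal.ofReal (a * (c ^ (s + 1) / (s + 1)) + b * (-c ^ (t + 1) / (t + 1))) := by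
  have hst : 0 < s + 1 := by linarith
  have htt : t + 1 < 0 := by linarith
  have hcs := Real.rpow_pos_of_pos hc (s + 1)
  have hct := Real.rpow_pos_of_pos hc (t + 1)
  rw [setLIntegral_Ioi_eq_add hc, setLIntegral_congr_fun measurableSet_Ioc h₁,
    setLIntegral_congr_fun measurableSet_Ioi h₂,
    ENNReal.ofReal_add (by positivity)
      (mul_nonneg hb (div_nonneg_of_nonpos (by linarith) htt.le))]
  congr 1
  · rw [← ofReal_integral_eq_lintegral_ofReal, integral_const_mul,
      ← intervalIntegral.integral_of_le hc.le, integral_rpow (Or.inl hs), Real.zero_rpow hst.ne',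
      sub_zero]
    · exact ((intervalIntegrable_iff_integrableOn_Ioc_of_le hc.le).1
        (intervalIntegral.intervalIntegrable_rpow' hs)).const_mul a
    · filter_upwards [ae_restrict_mem measurableSet_Ioc] with y hy
      have := hy.1
      simp only [Pi.zero_apply]
      positivity
  · rw [← ofReal_integral_eq_lintegral_ofReal, integral_const_mul, integral_Ioi_rpow_of_lt ht hc]
    · exact (integrableOn_Ioi_rpow_of_lt ht hc).const_mul b
    · filter_upwards [ae_restrict_mem measurableSet_Ioi] with y hy
      have : 0 < y := hc.trans hy
      simp only [Pi.zero_apply]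
      positivity

/-- By homogeneity of degree `-1`, the weight `y^(-1/2)` is reproduced up to a constant. The part
below the diagonal contributes `1/(ν+1)`, the part above `1/(ν-1)`; in the column integral the roles
are exchanged. -/
theorem lintegral_powerKernel_row {ν x : ℝ} (hν : 1 < ν) (hx : 0 < x) :
    ∫⁻ y in Ioi 0, ENNReal.ofReal (powerKernel ν x y / x) * ENNReal.ofReal (y ^ (-(1 / 2) : ℝ))
      = ENNReal.ofReal (1 / (ν + 1) + 1 / (ν - 1)) * ENNReal.ofReal (x ^ (-(1 / 2) : ℝ)) := by
  have h1 : 0 < ν - 1 := by linarith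
  rw [setLIntegral_Ioi_rpow_split (a := x ^ (-ν - 3 / 2)) (b := x ^ (ν - 3 / 2)) (c := x) (s := ν)
    (t := -ν) (by positivity) (by positivity) hx (by linarith) (by linarith)]
  · rw [← ENNReal.ofReal_mul (by positivity)]
    congr 1
    have e1 : x ^ (-ν - 3 / 2) * x ^ (ν + 1) = x ^ (-(1 / 2) : ℝ) := by
      rw [← Real.rpow_add hx]
      congr 1
      ring
    have e2 : x ^ (ν - 3 / 2) * x ^ (-ν + 1) = x ^ (-(1 / 2) : ℝ) := by
      rw [← Real.rpow_add hx]
      congr 1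
      ring
    rw [show -x ^ (-ν + 1) / (-ν + 1) = x ^ (-ν + 1) / (ν - 1) by
      rw [← neg_div_neg_eq, neg_neg]; congr 1; ring, ← mul_div_assoc, ← mul_div_assoc, e1, e2]
    ring
  · intro y hy
    have hy0 : 0 < y := hy.1
    rw [← ENNReal.ofReal_mul (div_nonneg (powerKernel_nonneg hx hy0) hx.le), powerKernel,
      if_pos hy.2, Real.div_rpow hy0.le hx.le]
    congr 1
    have e1 : y ^ (ν + 1 / 2) * y ^ (-(1 / 2) : ℝ) = y ^ ν := by
      rw [← Real.rpow_add hy0]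
      congr 1
      ring
    rw [← e1, show -ν - 3 / 2 = -(ν + 1 / 2) - 1 by ring, Real.rpow_sub_one hx.ne',
      Real.rpow_neg hx.le]
    ring
  · intro y hy
    have hy0 : 0 < y := hx.trans hy
    rw [← ENNReal.ofReal_mul (div_nonneg (powerKernel_nonneg hx hy0) hx.le), powerKernel,
      if_neg (not_le.2 hy), Real.div_rpow hx.le hy0.le]
    congr 1
    rw [show -ν = -(ν - 1 / 2) + -(1 / 2) by ring, Real.rpow_add hy0, Real.rpow_neg hy0.le (ν - 1 / 2),
      show ν - 3 / 2 = ν - 1 / 2 - 1 by ring, Real.rpow_sub_one hx.ne']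
    ring

theorem lintegral_powerKernel_col {ν y : ℝ} (hν : 1 < ν) (hy : 0 < y) :
    ∫⁻ x in Ioi 0, ENNReal.ofReal (powerKernel ν x y / x) * ENNReal.ofReal (x ^ (-(1 / 2) : ℝ))
      = ENNReal.ofReal (1 / (ν + 1) + 1 / (ν - 1)) * ENNReal.ofReal (y ^ (-(1 / 2) : ℝ)) := by
  have h1 : 0 < ν - 1 := by linarith
  rw [setLIntegral_Ioi_rpow_split (a := y ^ (-ν + 1 / 2)) (b := y ^ (ν + 1 / 2)) (c := y)
    (s := ν - 2) (t := -ν - 2) (by positivity) (by positivity) hy (by linarith) (by linarith)]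
  · rw [← ENNReal.ofReal_mul (by positivity)]
    congr 1
    have e1 : y ^ (-ν + 1 / 2) * y ^ (ν - 2 + 1) = y ^ (-(1 / 2) : ℝ) := by
      rw [← Real.rpow_add hy]
      congr 1
      ring
    have e2 : y ^ (ν + 1 / 2) * y ^ (-ν - 2 + 1) = y ^ (-(1 / 2) : ℝ) := by
      rw [← Real.rpow_add hy]
      congr 1
      ring
    rw [show -y ^ (-ν - 2 + 1) / (-ν - 2 + 1) = y ^ (-ν - 2 + 1) / (ν + 1) by
      rw [← neg_div_neg_eq, neg_neg]; congr 1; ring, ← mul_div_assoc, ← mul_div_assoc, e1, e2,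
      show ν - 2 + 1 = ν - 1 by ring]
    ring
  · intro x hx
    have hx0 : 0 < x := hx.1
    -- At `x = y` the definition selects the other branch, but both branches equal `1` there.
    have hk : powerKernel ν x y = (x / y) ^ (ν - 1 / 2) := by
      unfold powerKernel
      split_ifs with h
      · have : x = y := le_antisymm hx.2 h
        rw [this, div_self hy.ne', Real.one_rpow, Real.one_rpow]
      · rfl
    rw [← ENNReal.ofReal_mul (div_nonneg (powerKernel_nonneg hx0 hy) hx0.le), hk,
      Real.div_rpow hx0.le hy.le]
    congr 1
    have e1 : x ^ (ν - 1 / 2) * x ^ (-(1 / 2) : ℝ) = x ^ (ν - 2) * x := by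
      rw [← Real.rpow_add hx0, ← Real.rpow_add_one hx0.ne']
      congr 1
      ring
    rw [show -ν + 1 / 2 = -(ν - 1 / 2) by ring, Real.rpow_neg hy.le]
    calc _ = x ^ (ν - 1 / 2) * x ^ (-(1 / 2) : ℝ) / (y ^ (ν - 1 / 2) * x) := by ring
      _ = _ := by
        rw [e1]
        field_simp
  · intro x hx
    have hx0 : 0 < x := hy.trans hx
    have hx' : y ≤ x := le_of_lt hx
    rw [← ENNReal.ofReal_mul (div_nonneg (powerKernel_nonneg hx0 hy) hx0.le), powerKernel,
      if_pos hx', Real.div_rpow hy.le hx0.le]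
    congr 1
    rw [show -ν - 2 = -(ν + 1 / 2) - 1 + -(1 / 2) by ring, Real.rpow_add hx0 (-(ν + 1 / 2) - 1),
      Real.rpow_sub_one hx0.ne', Real.rpow_neg hx0.le (ν + 1 / 2)]
    ring

theorem setLIntegral_Ioc_deriv {g g' : ℝ → ℝ} {a b : ℝ} (hab : a ≤ b)
    (hg : ∀ x ∈ Icc a b, HasDerivAt g (g' x) x) (hc : ContinuousOn g' (Icc a b))
    (hpos : ∀ x ∈ Icc a b, 0 ≤ g' x) :
    ∫⁻ x in Ioc a b, ENNReal.ofReal (g' x) = ENNReal.ofReal (g b - g a) := by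
  have hi : IntervalIntegrable g' volume a b := by
    refine ContinuousOn.intervalIntegrable ?_
    rwa [uIcc_of_le hab]
  rw [← ofReal_integral_eq_lintegral_ofReal, ← intervalIntegral.integral_of_le hab,
    intervalIntegral.integral_eq_sub_of_hasDerivAt (by rwa [uIcc_of_le hab]) hi]
  · exact (intervalIntegrable_iff_integrableOn_Ioc_of_le hab).1 hi
  · filter_upwards [ae_restrict_mem measurableSet_Ioc] with x hx using hpos x ⟨hx.1.le, hx.2⟩

/-- Monotone exhaustion bounds the improper integral without knowing limits at the endpoint; the
next lemma does the same at `0`. -/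
theorem setLIntegral_Ioi_le_of_forall_Ioc {f : ℝ → ℝ≥0∞} {a : ℝ} {C : ℝ≥0∞}
    (h : ∀ b, a ≤ b → ∫⁻ x in Ioc a b, f x ≤ C) : ∫⁻ x in Ioi a, f x ≤ C := by
  have hU : Ioi a = ⋃ n : ℕ, Ioc a (a + n) := by
    ext x
    simp only [mem_Ioi, mem_iUnion, mem_Ioc]
    refine ⟨fun hx => ?_, fun ⟨n, hn⟩ => hn.1⟩
    obtain ⟨n, hn⟩ := exists_nat_ge (x - a)
    exact ⟨n, hx, by linarith⟩
  rw [hU, setLIntegral_iUnion_of_directed]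
  · exact iSup_le fun n => h _ (by simp)
  · refine Monotone.directed_le fun m n hmn => Ioc_subset_Ioc_right ?_
    gcongr

theorem setLIntegral_Ioc_zero_le_of_forall {f : ℝ → ℝ≥0∞} {b : ℝ} {C : ℝ≥0∞}
    (h : ∀ a, 0 < a → ∫⁻ x in Ioc a b, f x ≤ C) : ∫⁻ x in Ioc 0 b, f x ≤ C := by
  have hU : Ioc 0 b = ⋃ n : ℕ, Ioc (1 / ((n : ℝ) + 1)) b := by
    ext x
    simp only [mem_iUnion, mem_Ioc]
    refine ⟨fun hx => ?_, fun ⟨n, hn⟩ => ⟨lt_trans (by positivity) hn.1, hn.2⟩⟩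
    obtain ⟨n, hn⟩ := exists_nat_one_div_lt hx.1
    exact ⟨n, hn, hx.2⟩
  rw [hU, setLIntegral_iUnion_of_directed]
  · exact iSup_le fun n => h _ (by positivity)
  · refine Monotone.directed_le fun m n hmn => Ioc_subset_Ioc_left ?_
    gcongr

namespace BesselPair

variable {ν β : ℝ} {φ ψ φ' ψ' : ℝ → ℝ}

theorem continuousOn_left (h : BesselPair ν β φ ψ φ' ψ') : ContinuousOn φ (Ioi 0) :=
  fun x hx => (h.hasDerivAt_left x hx).continuousAt.continuousWithinAt

theorem continuousOn_left' (h : BesselPair ν β φ ψ φ' ψ') : ContinuousOn φ' (Ioi 0) :=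
  fun x hx => (h.hasDerivAt_left' x hx).continuousAt.continuousWithinAt

theorem continuousOn_right (h : BesselPair ν β φ ψ φ' ψ') : ContinuousOn ψ (Ioi 0) :=
  fun x hx => (h.hasDerivAt_right x hx).continuousAt.continuousWithinAt

theorem continuousOn_right' (h : BesselPair ν β φ ψ φ' ψ') : ContinuousOn ψ' (Ioi 0) :=
  fun x hx => (h.hasDerivAt_right' x hx).continuousAt.continuousWithinAt

theorem left_deriv_pos (h : BesselPair ν β φ ψ φ' ψ') (hν : 1 < ν) {x : ℝ} (hx : 0 < x) :
    0 < φ' x := by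
  have h1 := h.left_pos x hx
  have h2 := h.left_log x hx
  have h3 : 0 < (ν + 1 / 2) * φ x := by positivity
  exact pos_of_mul_pos_right (h3.trans_le h2) hx.le

theorem right_deriv_neg (h : BesselPair ν β φ ψ φ' ψ') (hν : 1 < ν) {x : ℝ} (hx : 0 < x) :
    ψ' x < 0 := by
  have h1 := h.right_pos x hx
  have h2 := h.right_log x hx
  have h3 : 0 < (ν - 1 / 2) * ψ x := mul_pos (by linarith) h1
  by_contra! h4
  have := mul_nonneg hx.le h4
  linarith

/-- The logarithmic-derivative bound says that `φ(t) t^(-(ν+1/2))` is nondecreasing. -/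
theorem left_le (h : BesselPair ν β φ ψ φ' ψ') {x y : ℝ} (hy : 0 < y) (hyx : y ≤ x) :
    φ y ≤ φ x * (y / x) ^ (ν + 1 / 2) := by
  have hx : 0 < x := hy.trans_le hyx
  have hd : ∀ t : ℝ, 0 < t → HasDerivAt (fun t => φ t * t ^ (-(ν + 1 / 2)))
      (t ^ (-(ν + 1 / 2)) / t * (t * φ' t - (ν + 1 / 2) * φ t)) t := fun t ht => by
    refine ((h.hasDerivAt_left t ht).mul
      (Real.hasDerivAt_rpow_const (p := -(ν + 1 / 2)) (Or.inl ht.ne'))).congr_deriv ?_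
    rw [Real.rpow_sub_one ht.ne']
    field_simp
    ring
  have hmono : MonotoneOn (fun t => φ t * t ^ (-(ν + 1 / 2))) (Ioi 0) := by
    refine monotoneOn_of_deriv_nonneg (convex_Ioi 0)
      (fun t ht => (hd t ht).continuousAt.continuousWithinAt)
      (fun t ht => ?_) (fun t ht => ?_)
    · rw [interior_Ioi] at ht
      exact (hd t ht).differentiableAt.differentiableWithinAt
    · rw [interior_Ioi] at ht
      have ht : 0 < t := ht
      rw [(hd t ht).deriv]
      exact mul_nonneg (by positivity) (sub_nonneg.2 (h.left_log t ht))
  have := hmono hy hx hyx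
  simp only [Real.rpow_neg hy.le, Real.rpow_neg hx.le, ← div_eq_mul_inv] at this
  rw [Real.div_rpow hy.le hx.le, mul_div_left_comm, mul_comm]
  exact (div_le_iff₀ (by positivity)).1 this

/-- Here `ψ(t) t^(ν-1/2)` is nonincreasing. -/
theorem right_le (h : BesselPair ν β φ ψ φ' ψ') {x y : ℝ} (hx : 0 < x) (hxy : x ≤ y) :
    ψ y ≤ ψ x * (x / y) ^ (ν - 1 / 2) := by
  have hy : 0 < y := hx.trans_le hxy
  have hd : ∀ t : ℝ, 0 < t → HasDerivAt (fun t => ψ t * t ^ (ν - 1 / 2))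
      (t ^ (ν - 1 / 2) / t * (t * ψ' t + (ν - 1 / 2) * ψ t)) t := fun t ht => by
    refine ((h.hasDerivAt_right t ht).mul
      (Real.hasDerivAt_rpow_const (p := ν - 1 / 2) (Or.inl ht.ne'))).congr_deriv ?_
    rw [Real.rpow_sub_one ht.ne']
    field_simp
  have hanti : AntitoneOn (fun t => ψ t * t ^ (ν - 1 / 2)) (Ioi 0) := by
    refine antitoneOn_of_deriv_nonpos (convex_Ioi 0)
      (fun t ht => (hd t ht).continuousAt.continuousWithinAt)
      (fun t ht => ?_) (fun t ht => ?_)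
    · rw [interior_Ioi] at ht
      exact (hd t ht).differentiableAt.differentiableWithinAt
    · rw [interior_Ioi] at ht
      have ht : 0 < t := ht
      rw [(hd t ht).deriv]
      refine mul_nonpos_of_nonneg_of_nonpos (by positivity) ?_
      linarith [h.right_log t ht]
  have := hanti hx hy hxy
  simp only at this
  rw [Real.div_rpow hx.le hy.le, ← mul_div_assoc]
  exact (le_div_iff₀ (by positivity)).2 this

/-- Multiply the two logarithmic bounds by `ψ` and `φ` and add: `2ν φψ ≤ x (φ'ψ - φψ') = x`. -/
theorem left_mul_right_le (h : BesselPair ν β φ ψ φ' ψ') (hν : 1 < ν) {x : ℝ} (hx : 0 < x) :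
    φ x * ψ x ≤ x / (2 * ν) := by
  have h1 := mul_le_mul_of_nonneg_right (h.left_log x hx) (h.right_pos x hx).le
  have h2 := mul_le_mul_of_nonneg_left (h.right_log x hx) (h.left_pos x hx).le
  rw [le_div_iff₀ (by linarith)]
  linear_combination h1 + h2 + x * h.wronskian x hx

/-- Monotonicity of the rescaled solutions reduces the estimate to the diagonal values `|p| φ` and
`|q| ψ`. -/
theorem abs_greenKernel_le (h : BesselPair ν β φ ψ φ' ψ') {p q : ℝ → ℝ} {x y M : ℝ}
    (hp : |p x| * φ x ≤ M) (hq : |q x| * ψ x ≤ M) (hx : 0 < x) (hy : 0 < y) :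
    |greenKernel φ ψ p q x y| ≤ M * powerKernel ν x y := by
  unfold greenKernel powerKernel
  split_ifs with hyx
  · rw [abs_mul, abs_of_pos (h.left_pos y hy)]
    calc |p x| * φ y ≤ |p x| * (φ x * (y / x) ^ (ν + 1 / 2)) := by
          gcongr
          exact h.left_le hy hyx
      _ = |p x| * φ x * (y / x) ^ (ν + 1 / 2) := by ring
      _ ≤ _ := by gcongr
  · rw [abs_mul, abs_of_pos (h.right_pos y hy)]
    calc |q x| * ψ y ≤ |q x| * (ψ x * (x / y) ^ (ν - 1 / 2)) := by
          gcongr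
          exact h.right_le hx (not_le.1 hyx).le
      _ = |q x| * ψ x * (x / y) ^ (ν - 1 / 2) := by ring
      _ ≤ _ := by gcongr

theorem abs_green_le (h : BesselPair ν β φ ψ φ' ψ') (hν : 1 < ν) {x y : ℝ} (hx : 0 < x)
    (hy : 0 < y) : |greenKernel φ ψ ψ φ x y| ≤ x / (2 * ν) * powerKernel ν x y := by
  have h1 := h.left_mul_right_le hν hx
  refine h.abs_greenKernel_le ?_ ?_ hx hy
  · rwa [abs_of_pos (h.right_pos x hx), mul_comm]
  · rwa [abs_of_pos (h.left_pos x hx)]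

/-- The Wronskian writes `1` as the sum of the positive terms `φ'ψ` and `-φψ'`, so each is at most
`1`. -/
theorem abs_green_deriv_le (h : BesselPair ν β φ ψ φ' ψ') (hν : 1 < ν) {x y : ℝ} (hx : 0 < x)
    (hy : 0 < y) : |greenKernel φ ψ ψ' φ' x y| ≤ powerKernel ν x y := by
  have h1 := mul_pos (h.left_deriv_pos hν hx) (h.right_pos x hx)
  have h2 := mul_pos (h.left_pos x hx) (neg_pos.2 (h.right_deriv_neg hν hx))
  have h3 := h.wronskian x hx
  rw [← one_mul (powerKernel ν x y)]
  refine h.abs_greenKernel_le ?_ ?_ hx hy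
  · rw [abs_of_neg (h.right_deriv_neg hν hx)]
    linarith
  · rw [abs_of_pos (h.left_deriv_pos hν hx)]
    linarith

theorem green_nonneg (h : BesselPair ν β φ ψ φ' ψ') {x y : ℝ} (hx : 0 < x) (hy : 0 < y) :
    0 ≤ greenKernel φ ψ ψ φ x y := by
  have := h.left_pos x hx
  have := h.left_pos y hy
  have := h.right_pos x hx
  have := h.right_pos y hy
  unfold greenKernel
  split_ifs <;> positivity

theorem sq_le_potential (hν : 1 < ν) (x : ℝ) : β ^ 2 ≤ besselPotential ν β x := by
  have : 0 ≤ ν ^ 2 - 1 / 4 := by nlinarith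
  have : 0 ≤ (ν ^ 2 - 1 / 4) / x ^ 2 := by positivity
  unfold besselPotential
  linarith

theorem continuousOn_potential (ν β : ℝ) : ContinuousOn (besselPotential ν β) (Ioi 0) := by
  unfold besselPotential
  refine continuousOn_const.add (continuousOn_const.div (by fun_prop) fun x hx => ?_)
  exact pow_ne_zero 2 (ne_of_gt hx)

/-- Since `β² φ ≤ V φ = φ''`, the fundamental theorem applies; the lower boundary value `φ'(a)` is
positive and can be dropped. For `ψ` the dropped value is `ψ'(b) < 0`. -/
theorem lintegral_left_le (h : BesselPair ν β φ ψ φ' ψ') (hν : 1 < ν) {x : ℝ} :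
    ∫⁻ y in Ioc 0 x, ENNReal.ofReal (β ^ 2 * φ y) ≤ ENNReal.ofReal (φ' x) := by
  refine setLIntegral_Ioc_zero_le_of_forall fun a ha => ?_
  rcases le_or_gt a x with hax | hax
  · have hsub : Icc a x ⊆ Ioi 0 := fun y hy => ha.trans_le hy.1
    calc ∫⁻ y in Ioc a x, ENNReal.ofReal (β ^ 2 * φ y)
        ≤ ∫⁻ y in Ioc a x, ENNReal.ofReal (besselPotential ν β y * φ y) := by
          refine setLIntegral_mono' measurableSet_Ioc fun y hy => ENNReal.ofReal_le_ofReal ?_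
          exact mul_le_mul_of_nonneg_right (sq_le_potential hν y) (h.left_pos y (ha.trans hy.1)).le
      _ = ENNReal.ofReal (φ' x - φ' a) :=
          setLIntegral_Ioc_deriv hax (fun y hy => h.hasDerivAt_left' y (hsub hy))
            (((continuousOn_potential ν β).mul h.continuousOn_left).mono hsub)
            fun y hy => mul_nonneg ((sq_nonneg β).trans (sq_le_potential hν y))
              (h.left_pos y (hsub hy)).le
      _ ≤ _ := ENNReal.ofReal_le_ofReal (by linarith [h.left_deriv_pos hν ha])
  · simp [Ioc_eq_empty (not_lt.2 hax.le)]

theorem lintegral_right_le (h : BesselPair ν β φ ψ φ' ψ') (hν : 1 < ν) {x : ℝ} (hx : 0 < x) :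
    ∫⁻ y in Ioi x, ENNReal.ofReal (β ^ 2 * ψ y) ≤ ENNReal.ofReal (-ψ' x) := by
  refine setLIntegral_Ioi_le_of_forall_Ioc fun b hxb => ?_
  have hsub : Icc x b ⊆ Ioi 0 := fun y hy => hx.trans_le hy.1
  calc ∫⁻ y in Ioc x b, ENNReal.ofReal (β ^ 2 * ψ y)
      ≤ ∫⁻ y in Ioc x b, ENNReal.ofReal (besselPotential ν β y * ψ y) := by
        refine setLIntegral_mono' measurableSet_Ioc fun y hy => ENNReal.ofReal_le_ofReal ?_
        exact mul_le_mul_of_nonneg_right (sq_le_potential hν y) (h.right_pos y (hx.trans hy.1)).le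
    _ = ENNReal.ofReal (ψ' b - ψ' x) :=
        setLIntegral_Ioc_deriv hxb (fun y hy => h.hasDerivAt_right' y (hsub hy))
          (((continuousOn_potential ν β).mul h.continuousOn_right).mono hsub)
          fun y hy => mul_nonneg ((sq_nonneg β).trans (sq_le_potential hν y))
            (h.right_pos y (hsub hy)).le
    _ ≤ _ := ENNReal.ofReal_le_ofReal
        (by linarith [h.right_deriv_neg hν (hx.trans_le hxb)])

/-- Splitting at `x`, the two one-sided bounds add up to `ψφ' - φψ'`, the Wronskian. -/
theorem lintegral_green_le (h : BesselPair ν β φ ψ φ' ψ') (hν : 1 < ν) {x : ℝ} (hx : 0 < x) :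
    ∫⁻ y in Ioi 0, ENNReal.ofReal (β ^ 2 * greenKernel φ ψ ψ φ x y) ≤ 1 := by
  have hψ := h.right_pos x hx
  have hφ := h.left_pos x hx
  rw [setLIntegral_Ioi_eq_add hx]
  calc _ = (∫⁻ y in Ioc 0 x, ENNReal.ofReal (ψ x) * ENNReal.ofReal (β ^ 2 * φ y))
        + ∫⁻ y in Ioi x, ENNReal.ofReal (φ x) * ENNReal.ofReal (β ^ 2 * ψ y) := by
        congr 1
        · refine setLIntegral_congr_fun measurableSet_Ioc fun y hy => ?_
          simp only [greenKernel, if_pos hy.2]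
          rw [← ENNReal.ofReal_mul hψ.le]
          congr 1
          ring
        · refine setLIntegral_congr_fun measurableSet_Ioi fun y hy => ?_
          simp only [greenKernel, if_neg (not_le.2 (mem_Ioi.1 hy))]
          rw [← ENNReal.ofReal_mul hφ.le]
          congr 1
          ring
    _ ≤ ENNReal.ofReal (ψ x) * ENNReal.ofReal (φ' x)
        + ENNReal.ofReal (φ x) * ENNReal.ofReal (-ψ' x) := by
        rw [lintegral_const_mul' _ _ ENNReal.ofReal_ne_top,
          lintegral_const_mul' _ _ ENNReal.ofReal_ne_top]
        gcongr
        · exact h.lintegral_left_le hν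
        · exact h.lintegral_right_le hν hx
    _ = 1 := by
        have h1 := h.left_deriv_pos hν hx
        have h2 := h.right_deriv_neg hν hx
        rw [← ENNReal.ofReal_mul hψ.le, ← ENNReal.ofReal_mul hφ.le,
          ← ENNReal.ofReal_add (by positivity) (mul_nonneg hφ.le (by linarith)),
          ← ENNReal.ofReal_one]
        congr 1
        linarith [h.wronskian x hx]

theorem green_symm (x y : ℝ) : greenKernel φ ψ ψ φ x y = greenKernel φ ψ ψ φ y x := by
  unfold greenKernel
  rcases lt_trichotomy x y with h | h | h
  · rw [if_neg (not_le.2 h), if_pos h.le, mul_comm]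
  · rw [h]
  · rw [if_pos h.le, if_neg (not_le.2 h), mul_comm]

end BesselPair

/-! ### Test functions, density and weak derivatives -/

namespace IsTestFunction

theorem eq_zero_of_nonpos {u : ℝ → ℂ} (hu : IsTestFunction u) {x : ℝ} (hx : x ≤ 0) : u x = 0 :=
  image_eq_zero_of_notMem_tsupport fun h => not_lt.2 hx (hu.support h)

theorem eventuallyEq_zero {u : ℝ → ℂ} (hu : IsTestFunction u) {x : ℝ} (hx : x ≤ 0) :
    u =ᶠ[𝓝 x] 0 :=
  notMem_tsupport_iff_eventuallyEq.1 fun h => not_lt.2 hx (hu.support h)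

theorem differentiable {u : ℝ → ℂ} (hu : IsTestFunction u) : Differentiable ℝ u :=
  hu.smooth.differentiable (by simp)

theorem continuous_mul {u f : ℝ → ℂ} (hu : IsTestFunction u) (hf : ContinuousOn f (Ioi 0)) :
    Continuous fun x => f x * u x :=
  (hf.mul hu.smooth.continuous.continuousOn).continuous_of_tsupport_subset isOpen_Ioi
    ((tsupport_mul_subset_right (f := f) (g := u)).trans hu.support)

theorem hasCompactSupport_mul {u : ℝ → ℂ} (hu : IsTestFunction u) (f : ℝ → ℂ) :
    HasCompactSupport fun x => f x * u x :=
  hu.compact.mul_left (f := f)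

theorem mul_id {u : ℝ → ℂ} (hu : IsTestFunction u) :
    IsTestFunction fun t : ℝ => (t : ℂ) * u t where
  smooth := Complex.ofRealCLM.contDiff.mul hu.smooth
  compact := hu.hasCompactSupport_mul _
  support := (tsupport_mul_subset_right (f := fun t : ℝ => (t : ℂ)) (g := u)).trans hu.support

protected theorem deriv {u : ℝ → ℂ} (hu : IsTestFunction u) : IsTestFunction (deriv u) where
  smooth := by
    have h : ContDiff ℝ ((⊤ : ℕ∞) + 1) u := hu.smooth
    exact (contDiff_succ_iff_deriv.1 h).2.2
  compact := hu.compact.deriv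
  support := tsupport_deriv_subset.trans hu.support

theorem star {u : ℝ → ℂ} (hu : IsTestFunction u) :
    IsTestFunction fun t => (starRingEnd ℂ) (u t) where
  smooth := Complex.conjCLE.contDiff.comp hu.smooth
  compact := hu.compact.comp_left (map_zero _)
  support := (tsupport_comp_subset (map_zero (starRingEnd ℂ)) u).trans hu.support

/-- Integration against a test function, as a continuous functional on `L²(0,∞)`. -/
theorem exists_clm_integral_mul {w : ℝ → ℂ} (hw : IsTestFunction w) :
    ∃ J : L2Half →L[ℂ] ℂ, ∀ f : L2Half, J f = ∫ x in Ioi (0 : ℝ), f x * w x := by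
  refine ⟨innerSL ℂ hw.star.toL2, fun f => ?_⟩
  rw [innerSL_apply_apply, L2.inner_def]
  refine integral_congr_ae ?_
  filter_upwards [hw.star.memLp.coeFn_toLp] with x hx
  rw [RCLike.inner_apply, toL2, hx, Complex.conj_conj]

end IsTestFunction

/-- An element orthogonal to all test functions vanishes almost everywhere by the fundamental lemma
of the calculus of variations. -/
theorem dense_span_testFunctions :
    Dense (Submodule.span ℂ
      {f : L2Half | ∃ (u : ℝ → ℂ) (hu : IsTestFunction u), hu.toL2 = f} : Set L2Half) := by
  rw [Submodule.dense_iff_topologicalClosure_eq_top, Submodule.topologicalClosure_eq_top_iff,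
    Submodule.eq_bot_iff]
  intro f hf
  rw [Submodule.mem_orthogonal] at hf
  have hloc : LocallyIntegrableOn f (Ioi 0) (volume.restrict (Ioi (0 : ℝ))) :=
    ((Lp.memLp f).locallyIntegrable (by norm_num)).locallyIntegrableOn _
  have h := isOpen_Ioi.ae_eq_zero_of_integral_contDiff_smul_eq_zero hloc fun g hg hgc hgs => by
    have hu : IsTestFunction fun x => (g x : ℂ) :=
      ⟨Complex.ofRealCLM.contDiff.comp hg, hgc.comp_left Complex.ofReal_zero,
        (tsupport_comp_subset Complex.ofReal_zero g).trans hgs⟩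
    have h1 := hf _ (Submodule.subset_span ⟨_, hu, rfl⟩)
    rw [L2.inner_def] at h1
    rw [← h1]
    refine integral_congr_ae ?_
    filter_upwards [hu.memLp.coeFn_toLp] with x hx
    rw [RCLike.inner_apply, IsTestFunction.toL2, hx, Complex.conj_ofReal, Complex.real_smul,
      mul_comm]
  rw [Lp.eq_zero_iff_ae_eq_zero]
  filter_upwards [h, ae_restrict_mem measurableSet_Ioi] with x hx hx0 using hx hx0

/-- Integration by parts for a function that is continuously differentiable on `(0,∞)`. -/
theorem integral_mul_deriv_eq_neg {F F' φ : ℝ → ℂ}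
    (hF : ∀ x, 0 < x → HasDerivAt F (F' x) x) (hF' : ContinuousOn F' (Ioi 0))
    (hφ : IsTestFunction φ) :
    ∫ x in Ioi (0 : ℝ), F x * deriv (fun t : ℝ => (t : ℂ) * φ t) x
      = -∫ x in Ioi (0 : ℝ), (x : ℂ) * F' x * φ x := by
  have hFc : ContinuousOn F (Ioi 0) := fun x hx => (hF x hx).continuousAt.continuousWithinAt
  set w : ℝ → ℂ := fun t : ℝ => (t : ℂ) * φ t with hw
  have hwt : IsTestFunction w := hφ.mul_id
  have i1 : Integrable fun x => F x * deriv w x :=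
    (hwt.deriv.continuous_mul hFc).integrable_of_hasCompactSupport
      (hwt.deriv.hasCompactSupport_mul _)
  have i2 : Integrable fun x => F' x * w x :=
    (hwt.continuous_mul hF').integrable_of_hasCompactSupport (hwt.hasCompactSupport_mul _)
  have i3 : Integrable fun x => F x * w x :=
    (hwt.continuous_mul hFc).integrable_of_hasCompactSupport (hwt.hasCompactSupport_mul _)
  -- Nothing is known about `F` on `(-∞,0]`, but `w` vanishes near each such point, so the product
  -- is differentiable on the whole line.
  have hd : ∀ x, HasDerivAt (fun x => F x * w x) (F' x * w x + F x * deriv w x) x := by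
    intro x
    rcases lt_or_ge 0 x with hx | hx
    · exact (hF x hx).mul (hwt.differentiable x).hasDerivAt
    · rw [hwt.eq_zero_of_nonpos hx, hwt.deriv.eq_zero_of_nonpos hx, mul_zero, mul_zero, add_zero]
      refine (hasDerivAt_const x (0 : ℂ)).congr_of_eventuallyEq ?_
      filter_upwards [hwt.eventuallyEq_zero hx] with y hy
      rw [hy, Pi.zero_apply, mul_zero]
  have h0 := integral_eq_zero_of_hasDerivAt_of_integrable hd (i2.add i1) i3
  rw [integral_add i2 i1] at h0
  rw [setIntegral_eq_integral_of_forall_compl_eq_zero, setIntegral_eq_integral_of_forall_compl_eq_zero,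
    eq_neg_iff_add_eq_zero, add_comm, ← h0]
  · congr 2
    ext x
    simp only [hw]
    ring
  · intro x hx
    rw [hφ.eq_zero_of_nonpos (not_lt.1 hx), mul_zero]
  · intro x hx
    rw [hwt.deriv.eq_zero_of_nonpos (not_lt.1 hx), mul_zero]

/-- Two bounded operators on `L²(0,∞)` are related by the weak operator `X ∂ₓ` as soon as they are
so in the classical sense on test functions. -/
theorem isWeakEuler_of_testFunctions {S T : L2Half →L[ℂ] L2Half}
    (h : ∀ (u : ℝ → ℂ) (hu : IsTestFunction u), ∃ F F' : ℝ → ℂ,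
      (∀ x, 0 < x → HasDerivAt F (F' x) x) ∧ ContinuousOn F' (Ioi 0) ∧
      S hu.toL2 =ᵐ[volume.restrict (Ioi (0 : ℝ))] F ∧
      T hu.toL2 =ᵐ[volume.restrict (Ioi (0 : ℝ))] fun x => (x : ℂ) * F' x) (u : L2Half) :
    IsWeakEuler (S u) (T u) := by
  intro φ hφ
  obtain ⟨J₁, hJ₁⟩ := hφ.mul_id.deriv.exists_clm_integral_mul
  obtain ⟨J₂, hJ₂⟩ := hφ.exists_clm_integral_mul
  -- For fixed `φ`, both sides of the weak identity are continuous functionals of `u`, so agreement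
  -- on test functions suffices.
  have key : J₁.comp S = -(J₂.comp T) := by
    refine ContinuousLinearMap.ext_on dense_span_testFunctions ?_
    rintro f ⟨u, hu, rfl⟩
    obtain ⟨F, F', hF, hF', hS, hT⟩ := h u hu
    rw [neg_apply, ContinuousLinearMap.comp_apply,
      ContinuousLinearMap.comp_apply, hJ₁, hJ₂]
    refine Eq.trans ?_ ((integral_mul_deriv_eq_neg hF hF' hφ).trans ?_)
    · refine integral_congr_ae ?_
      filter_upwards [hS] with x hx
      rw [hx]
    · congr 1
      refine integral_congr_ae ?_
      filter_upwards [hT] with x hx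
      rw [hx]
  have := congrArg (fun L : L2Half →L[ℂ] ℂ => L u) key
  simpa only [neg_apply, ContinuousLinearMap.comp_apply, hJ₁, hJ₂] using this

theorem contDiffOn_two_of_hasDerivAt {f f₁ f₂ : ℝ → ℂ} {s : Set ℝ} (hs : IsOpen s)
    (h₁ : ∀ x ∈ s, HasDerivAt f (f₁ x) x) (h₂ : ∀ x ∈ s, HasDerivAt f₁ (f₂ x) x)
    (hc : ContinuousOn f₂ s) : ContDiffOn ℝ 2 f s := by
  rw [show (2 : WithTop ℕ∞) = 1 + 1 by norm_num, contDiffOn_succ_iff_deriv_of_isOpen hs]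
  refine ⟨fun x hx => (h₁ x hx).differentiableAt.differentiableWithinAt, by simp, ?_⟩
  refine ContDiffOn.congr (f := f₁) ?_ fun x hx => (h₁ x hx).deriv
  rw [show (1 : WithTop ℕ∞) = 0 + 1 by norm_num, contDiffOn_succ_iff_deriv_of_isOpen hs]
  refine ⟨fun x hx => (h₂ x hx).differentiableAt.differentiableWithinAt, by simp, ?_⟩
  rw [contDiffOn_zero]
  exact hc.congr fun x hx => (h₂ x hx).deriv

/-! ### Variation of parameters -/

/-- The function `x ↦ p(x) ∫₀ˣ φ u + q(x) ∫ₓ^∞ ψ u`. -/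
noncomputable def greenSolution (φ ψ p q : ℝ → ℝ) (u : ℝ → ℂ) (x : ℝ) : ℂ :=
  p x * (∫ t in (0 : ℝ)..x, (φ t : ℂ) * u t)
    + q x * ((∫ t in Ioi (0 : ℝ), (ψ t : ℂ) * u t) - ∫ t in (0 : ℝ)..x, (ψ t : ℂ) * u t)

theorem integral_greenKernel_mul {φ ψ p q : ℝ → ℝ} {u : ℝ → ℂ} {x : ℝ} (hx : 0 < x)
    (hφ : ContinuousOn φ (Ioi 0)) (hψ : ContinuousOn ψ (Ioi 0)) (hu : IsTestFunction u) :
    ∫ y in Ioi 0, (greenKernel φ ψ p q x y : ℂ) * u y = greenSolution φ ψ p q u x := by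
  have hφC : ContinuousOn (fun t => (φ t : ℂ)) (Ioi 0) :=
    Complex.continuous_ofReal.comp_continuousOn hφ
  have hψC : ContinuousOn (fun t => (ψ t : ℂ)) (Ioi 0) :=
    Complex.continuous_ofReal.comp_continuousOn hψ
  have iφ : Integrable fun t => (φ t : ℂ) * u t :=
    (hu.continuous_mul hφC).integrable_of_hasCompactSupport (hu.hasCompactSupport_mul _)
  have iψ : Integrable fun t => (ψ t : ℂ) * u t :=
    (hu.continuous_mul hψC).integrable_of_hasCompactSupport (hu.hasCompactSupport_mul _)
  have e1 : EqOn (fun y => (greenKernel φ ψ p q x y : ℂ) * u y)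
      (fun y => (p x : ℂ) * ((φ y : ℂ) * u y)) (Ioc 0 x) := fun y hy => by
    simp only [greenKernel, if_pos hy.2]
    push_cast
    ring
  have e2 : EqOn (fun y => (greenKernel φ ψ p q x y : ℂ) * u y)
      (fun y => (q x : ℂ) * ((ψ y : ℂ) * u y)) (Ioi x) := fun y hy => by
    simp only [greenKernel, if_neg (not_le.2 (mem_Ioi.1 hy))]
    push_cast
    ring
  have hdisj : Disjoint (Ioc 0 x) (Ioi x) :=
    Set.disjoint_left.2 fun y hy hy' => not_lt.2 hy.2 hy'
  have hS : ∫ t in Ioi (0 : ℝ), (ψ t : ℂ) * u t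
      = (∫ t in (0 : ℝ)..x, (ψ t : ℂ) * u t) + ∫ t in Ioi x, (ψ t : ℂ) * u t := by
    rw [intervalIntegral.integral_of_le hx.le, ← Ioc_union_Ioi_eq_Ioi hx.le,
      setIntegral_union hdisj measurableSet_Ioi iψ.integrableOn iψ.integrableOn]
  rw [greenSolution, hS, add_sub_cancel_left, ← Ioc_union_Ioi_eq_Ioi hx.le,
    setIntegral_union hdisj measurableSet_Ioi
      ((iφ.const_mul (p x : ℂ)).integrableOn.congr_fun e1.symm measurableSet_Ioc)
      ((iψ.const_mul (q x : ℂ)).integrableOn.congr_fun e2.symm measurableSet_Ioi),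
    setIntegral_congr_fun measurableSet_Ioc e1, setIntegral_congr_fun measurableSet_Ioi e2,
    integral_const_mul, integral_const_mul, intervalIntegral.integral_of_le hx.le]

/-- Besides differentiating `p` and `q`, the moving endpoint produces `(pφ - qψ) u`. This vanishes
for `p = ψ`, `q = φ`, and equals `-u` for `p = ψ'`, `q = φ'` by the Wronskian. -/
theorem hasDerivAt_greenSolution {φ ψ p q p' q' : ℝ → ℝ} {u : ℝ → ℂ} {x : ℝ}
    (hφ : ContinuousOn φ (Ioi 0)) (hψ : ContinuousOn ψ (Ioi 0)) (hu : IsTestFunction u)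
    (hp : HasDerivAt p (p' x) x) (hq : HasDerivAt q (q' x) x) :
    HasDerivAt (greenSolution φ ψ p q u)
      (greenSolution φ ψ p' q' u x + ((p x * φ x - q x * ψ x : ℝ) : ℂ) * u x) x := by
  have hφC : ContinuousOn (fun t => (φ t : ℂ)) (Ioi 0) :=
    Complex.continuous_ofReal.comp_continuousOn hφ
  have hψC : ContinuousOn (fun t => (ψ t : ℂ)) (Ioi 0) :=
    Complex.continuous_ofReal.comp_continuousOn hψ
  have dφ := ((hu.continuous_mul hφC).integral_hasStrictDerivAt 0 x).hasDerivAt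
  have dψ := ((hu.continuous_mul hψC).integral_hasStrictDerivAt 0 x).hasDerivAt
  refine ((hp.ofReal_comp.mul dφ).add (hq.ofReal_comp.mul
    (dψ.const_sub (∫ t in Ioi (0 : ℝ), (ψ t : ℂ) * u t)))).congr_deriv ?_
  simp only [greenSolution]
  push_cast
  ring

/-! ### The resolvent operators -/

theorem exists_clm_of_abs_le_powerKernel {ν M : ℝ} (hν : 1 < ν) (hM : 0 ≤ M) {κ : ℝ → ℝ → ℝ}
    (hκ : AEStronglyMeasurable (Function.uncurry κ)
      ((volume.restrict (Ioi (0 : ℝ))).prod (volume.restrict (Ioi 0))))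
    (hle : ∀ x y, 0 < x → 0 < y → |κ x y| ≤ M * (powerKernel ν x y / x)) :
    ∃ T : L2Half →L[ℂ] L2Half, ‖T‖ ≤ M * (1 / (ν + 1) + 1 / (ν - 1)) ∧
      ∀ u : L2Half, T u =ᵐ[volume.restrict (Ioi (0 : ℝ))]
        fun x => ∫ y in Ioi (0 : ℝ), (κ x y : ℂ) * u y := by
  have h1 : 0 < ν - 1 := by linarith
  have he : ∀ x y, 0 < x → 0 < y →
      ‖κ x y‖ₑ ≤ ENNReal.ofReal M * ENNReal.ofReal (powerKernel ν x y / x) := fun x y hx hy => by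
    rw [← ofReal_norm, Real.norm_eq_abs, ← ENNReal.ofReal_mul hM]
    exact ENNReal.ofReal_le_ofReal (hle x y hx hy)
  refine exists_clm_of_schur (w := fun x => ENNReal.ofReal (x ^ (-(1 / 2) : ℝ)))
    (mul_nonneg hM (by positivity)) hκ (by fun_prop) ?_ ?_ ?_
  · filter_upwards [ae_restrict_mem measurableSet_Ioi] with x hx
    exact ⟨(ENNReal.ofReal_pos.2 (Real.rpow_pos_of_pos hx _)).ne', ENNReal.ofReal_ne_top⟩
  · filter_upwards [ae_restrict_mem measurableSet_Ioi] with x hx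
    rw [ENNReal.ofReal_mul hM, mul_assoc, ← lintegral_powerKernel_row hν hx,
      ← lintegral_const_mul' _ _ ENNReal.ofReal_ne_top]
    refine setLIntegral_mono' measurableSet_Ioi fun y hy => ?_
    rw [← mul_assoc]
    gcongr
    exact he x y hx hy
  · filter_upwards [ae_restrict_mem measurableSet_Ioi] with y hy
    rw [ENNReal.ofReal_mul hM, mul_assoc, ← lintegral_powerKernel_col hν hy,
      ← lintegral_const_mul' _ _ ENNReal.ofReal_ne_top]
    refine setLIntegral_mono' measurableSet_Ioi fun x hx => ?_
    rw [← mul_assoc]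
    gcongr
    exact he x y hx hy

/-- Each section of the kernel is in `L²`, so Cauchy–Schwarz gives absolute convergence at every `x
> 0`, not merely almost everywhere. -/
theorem lintegral_powerKernel_sq_lt_top {ν x : ℝ} (hν : 1 < ν) (hx : 0 < x) :
    ∫⁻ y in Ioi 0, ENNReal.ofReal (powerKernel ν x y ^ 2) < ∞ := by
  rw [setLIntegral_Ioi_rpow_split (a := x ^ (-(2 * ν + 1))) (b := x ^ (2 * ν - 1)) (c := x)
    (s := 2 * ν + 1) (t := -(2 * ν - 1)) (by positivity) (by positivity) hx (by linarith)
    (by linarith)]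
  · exact ENNReal.ofReal_lt_top
  · intro y hy
    have hy0 : 0 < y := hy.1
    rw [powerKernel, if_pos hy.2, ← Real.rpow_natCast, ← Real.rpow_mul (by positivity),
      Real.div_rpow hy0.le hx.le, Real.rpow_neg hx.le, div_eq_inv_mul]
    push_cast
    ring_nf
  · intro y hy
    have hy0 : 0 < y := hx.trans hy
    rw [powerKernel, if_neg (not_le.2 hy), ← Real.rpow_natCast, ← Real.rpow_mul (by positivity),
      Real.div_rpow hx.le hy0.le, Real.rpow_neg hy0.le, div_eq_mul_inv]
    push_cast
    ring_nf

namespace BesselPair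

variable {ν β : ℝ} {φ ψ φ' ψ' : ℝ → ℝ}

theorem memLp_green (h : BesselPair ν β φ ψ φ' ψ') (hν : 1 < ν) {x : ℝ} (hx : 0 < x) :
    MemLp (fun y => (greenKernel φ ψ ψ φ x y : ℂ)) 2 (volume.restrict (Ioi (0 : ℝ))) := by
  classical
  have hm : AEStronglyMeasurable (greenKernel φ ψ ψ φ x) (volume.restrict (Ioi 0)) := by
    have := AEStronglyMeasurable.piecewise (μ := volume.restrict (Ioi (0 : ℝ)))
      (measurableSet_Iic (a := x))
      (f := fun y => ψ x * φ y) (g := fun y => φ x * ψ y)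
      (h.continuousOn_left.aestronglyMeasurable_Ioi.const_mul _).restrict
      (h.continuousOn_right.aestronglyMeasurable_Ioi.const_mul _).restrict
    refine this.congr (Eventually.of_forall fun y => ?_)
    simp only [Set.piecewise, mem_Iic, greenKernel]
  refine ⟨Complex.continuous_ofReal.comp_aestronglyMeasurable hm, ?_⟩
  rw [eLpNorm_lt_top_iff_lintegral_rpow_enorm_lt_top (by norm_num) (by norm_num)]
  calc ∫⁻ y in Ioi (0 : ℝ), ‖(greenKernel φ ψ ψ φ x y : ℂ)‖ₑ ^ (2 : ℝ≥0∞).toReal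
      ≤ ∫⁻ y in Ioi (0 : ℝ), ENNReal.ofReal ((x / (2 * ν)) ^ 2)
        * ENNReal.ofReal (powerKernel ν x y ^ 2) := by
        refine setLIntegral_mono' measurableSet_Ioi fun y hy => ?_
        rw [ENNReal.toReal_ofNat, ENNReal.rpow_ofNat, ← ofReal_norm, Complex.norm_real,
          Real.norm_eq_abs, ← ENNReal.ofReal_pow (abs_nonneg _),
          ← ENNReal.ofReal_mul (by positivity), ← mul_pow]
        exact ENNReal.ofReal_le_ofReal
          (pow_le_pow_left₀ (abs_nonneg _) (h.abs_green_le hν hx hy) 2)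
    _ < ∞ := by
        rw [lintegral_const_mul' _ _ ENNReal.ofReal_ne_top]
        exact ENNReal.mul_lt_top ENNReal.ofReal_lt_top (lintegral_powerKernel_sq_lt_top hν hx)

theorem aestronglyMeasurable_green (h : BesselPair ν β φ ψ φ' ψ') {r : ℝ → ℝ}
    (hr : ContinuousOn r (Ioi 0)) {p q : ℝ → ℝ} (hp : ContinuousOn p (Ioi 0))
    (hq : ContinuousOn q (Ioi 0)) :
    AEStronglyMeasurable (Function.uncurry fun x y => r x * greenKernel φ ψ p q x y)
      ((volume.restrict (Ioi (0 : ℝ))).prod (volume.restrict (Ioi 0))) :=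
  hr.aestronglyMeasurable_Ioi.comp_fst.mul (aestronglyMeasurable_greenKernel
    h.continuousOn_left.aestronglyMeasurable_Ioi h.continuousOn_right.aestronglyMeasurable_Ioi
    hp.aestronglyMeasurable_Ioi hq.aestronglyMeasurable_Ioi)

/-- The operator `X⁻² K`. -/
theorem exists_clm_green (h : BesselPair ν β φ ψ φ' ψ') (hν : 1 < ν) :
    ∃ T : L2Half →L[ℂ] L2Half, ‖T‖ ≤ 1 / (2 * ν) * (1 / (ν + 1) + 1 / (ν - 1)) ∧
      ∀ u : L2Half, T u =ᵐ[volume.restrict (Ioi (0 : ℝ))] fun x =>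
        ((x ^ 2 : ℝ) : ℂ)⁻¹ * ∫ y in Ioi (0 : ℝ), (greenKernel φ ψ ψ φ x y : ℂ) * u y := by
  have hc : ContinuousOn (fun x : ℝ => (x ^ 2)⁻¹) (Ioi 0) :=
    ContinuousOn.inv₀ (by fun_prop) fun x hx => pow_ne_zero 2 (ne_of_gt hx)
  obtain ⟨T, hT, hTu⟩ := exists_clm_of_abs_le_powerKernel hν (M := 1 / (2 * ν))
    (by positivity) (h.aestronglyMeasurable_green hc h.continuousOn_right h.continuousOn_left)
    fun x y hx hy => by
      rw [abs_mul, abs_of_pos (by positivity)]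
      calc (x ^ 2)⁻¹ * |greenKernel φ ψ ψ φ x y|
          ≤ (x ^ 2)⁻¹ * (x / (2 * ν) * powerKernel ν x y) := by
            gcongr
            exact h.abs_green_le hν hx hy
        _ = _ := by
            field_simp
  refine ⟨T, hT, fun u => (hTu u).trans (Eventually.of_forall fun x => ?_)⟩
  simp only [Complex.ofReal_mul, mul_assoc, integral_const_mul, Complex.ofReal_inv]

/-- The operator `X⁻¹ ∂ₓ K`. -/
theorem exists_clm_green_deriv (h : BesselPair ν β φ ψ φ' ψ') (hν : 1 < ν) :
    ∃ T : L2Half →L[ℂ] L2Half, ‖T‖ ≤ 1 / (ν + 1) + 1 / (ν - 1) ∧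
      ∀ u : L2Half, T u =ᵐ[volume.restrict (Ioi (0 : ℝ))] fun x =>
        (x : ℂ)⁻¹ * ∫ y in Ioi (0 : ℝ), (greenKernel φ ψ ψ' φ' x y : ℂ) * u y := by
  have hc : ContinuousOn (fun x : ℝ => x⁻¹) (Ioi 0) :=
    ContinuousOn.inv₀ (by fun_prop) fun x hx => ne_of_gt hx
  obtain ⟨T, hT, hTu⟩ := exists_clm_of_abs_le_powerKernel hν (M := 1)
    (by positivity) (h.aestronglyMeasurable_green hc h.continuousOn_right' h.continuousOn_left')
    fun x y hx hy => by
      rw [abs_mul, abs_of_pos (by positivity), one_mul, div_eq_inv_mul]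
      gcongr
      exact h.abs_green_deriv_le hν hx hy
  rw [one_mul] at hT
  refine ⟨T, hT, fun u => (hTu u).trans (Eventually.of_forall fun x => ?_)⟩
  simp only [Complex.ofReal_mul, mul_assoc, integral_const_mul, Complex.ofReal_inv]

/-- The operator `β² K`. -/
theorem exists_clm_sq_mul_green (h : BesselPair ν β φ ψ φ' ψ') (hν : 1 < ν) :
    ∃ T : L2Half →L[ℂ] L2Half, ‖T‖ ≤ 1 ∧
      ∀ u : L2Half, T u =ᵐ[volume.restrict (Ioi (0 : ℝ))] fun x =>
        (β : ℂ) ^ 2 * ∫ y in Ioi (0 : ℝ), (greenKernel φ ψ ψ φ x y : ℂ) * u y := by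
  have hrow : ∀ x, 0 < x →
      ∫⁻ y in Ioi 0, ‖β ^ 2 * greenKernel φ ψ ψ φ x y‖ₑ * 1 ≤ ENNReal.ofReal 1 * 1 := fun x hx => by
    rw [ENNReal.ofReal_one, mul_one]
    refine le_trans (le_of_eq ?_) (h.lintegral_green_le hν hx)
    refine setLIntegral_congr_fun measurableSet_Ioi fun y hy => ?_
    simp only [mul_one]
    rw [Real.enorm_of_nonneg (mul_nonneg (sq_nonneg β) (h.green_nonneg hx hy))]
  -- With weight `1`, symmetry of the kernel turns the row bound into the column bound.
  obtain ⟨T, hT, hTu⟩ := exists_clm_of_schur (μ := volume.restrict (Ioi (0 : ℝ)))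
    (κ := fun x y => β ^ 2 * greenKernel φ ψ ψ φ x y) (w := fun _ => 1) zero_le_one
    (h.aestronglyMeasurable_green (r := fun _ => β ^ 2) continuousOn_const h.continuousOn_right
      h.continuousOn_left)
    aemeasurable_const (by simp)
    (by filter_upwards [ae_restrict_mem measurableSet_Ioi] with x hx using hrow x hx)
    (by
      filter_upwards [ae_restrict_mem measurableSet_Ioi] with y hy
      have := hrow y hy
      simpa only [green_symm (φ := φ) (ψ := ψ) y] using this)
  refine ⟨T, hT, fun u => (hTu u).trans (Eventually.of_forall fun x => ?_)⟩
  simp only [Complex.ofReal_mul, mul_assoc, integral_const_mul, Complex.ofReal_pow]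

/-- For a test function `u`, the function `K u` is differentiable. -/
theorem hasDerivAt_solution (h : BesselPair ν β φ ψ φ' ψ') {u : ℝ → ℂ} (hu : IsTestFunction u)
    {x : ℝ} (hx : 0 < x) :
    HasDerivAt (greenSolution φ ψ ψ φ u) (greenSolution φ ψ ψ' φ' u x) x := by
  have := hasDerivAt_greenSolution h.continuousOn_left h.continuousOn_right hu
    (h.hasDerivAt_right x hx) (h.hasDerivAt_left x hx)
  refine this.congr_deriv ?_
  rw [mul_comm (ψ x), sub_self, Complex.ofReal_zero, zero_mul, add_zero]

theorem hasDerivAt_solution' (h : BesselPair ν β φ ψ φ' ψ') {u : ℝ → ℂ} (hu : IsTestFunction u)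
    {x : ℝ} (hx : 0 < x) :
    HasDerivAt (greenSolution φ ψ ψ' φ' u)
      (besselPotential ν β x * greenSolution φ ψ ψ φ u x - u x) x := by
  have := hasDerivAt_greenSolution h.continuousOn_left h.continuousOn_right hu
    (p' := fun x => besselPotential ν β x * ψ x) (q' := fun x => besselPotential ν β x * φ x)
    (h.hasDerivAt_right' x hx) (h.hasDerivAt_left' x hx)
  refine this.congr_deriv ?_
  have hW : ψ' x * φ x - φ' x * ψ x = -1 := by linarith [h.wronskian x hx]
  rw [hW]
  simp only [greenSolution]
  push_cast
  ring

end BesselPair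

/-! ### The main estimate -/

theorem besselKernel_eq_greenKernel {ν β x y : ℝ} {φ ψ : ℝ → ℝ}
    (hφ : ∀ x, 0 < x → φ x = Real.sqrt x * besselI ν (β * x))
    (hψ : ∀ x, 0 < x → ψ x = Real.sqrt x * besselK ν (β * x)) (hx : 0 < x) (hy : 0 < y) :
    besselKernel ν β x y = greenKernel φ ψ ψ φ x y := by
  unfold besselKernel greenKernel
  rw [Real.sqrt_mul hx.le, hφ x hx, hφ y hy, hψ x hx, hψ y hy]
  split_ifs <;> ring

theorem eulerOp_congr {f g : ℝ → ℂ} (h : ∀ x, 0 < x → f x = g x) {x : ℝ} (hx : 0 < x) :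
    eulerOp f x = eulerOp g x := by
  have : f =ᶠ[𝓝 x] g := by
    filter_upwards [Ioi_mem_nhds hx] with y hy using h y hy
  rw [eulerOp, eulerOp, this.deriv_eq]

theorem mainTheorem9 (δ : ℝ) (hδ : 0 < δ) :
    ∃ C : ℝ, 0 < C ∧ ∀ ν β : ℝ, 3 / 2 + δ ≤ ν → 0 < β →
      ∃ T₀ T₁ T₂ : L2Half →L[ℂ] L2Half,
        -- `T₀ = X⁻² K` on all of `L²(0,∞)`, with absolutely convergent integrals
        (∀ u : L2Half,
          (∀ x : ℝ, 0 < x →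
            IntegrableOn (fun y : ℝ => (besselKernel ν β x y : ℂ) * u y) (Ioi 0)) ∧
          T₀ u =ᵐ[volume.restrict (Ioi (0 : ℝ))] scaledBesselOp ν β u) ∧
        -- `T₁ = (X ∂ₓ) X⁻² K` and `T₂ = (X ∂ₓ)² X⁻² K` on `L²(0,∞)`, with weak derivatives
        (∀ u : L2Half, IsWeakEuler (T₀ u) (T₁ u) ∧ IsWeakEuler (T₁ u) (T₂ u)) ∧
        -- on test functions the derivatives are classical
        (∀ (u : ℝ → ℂ) (hu : IsTestFunction u),
          ContDiffOn ℝ 2 (besselOp ν β u) (Ioi 0) ∧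
          T₀ hu.toL2 =ᵐ[volume.restrict (Ioi (0 : ℝ))] scaledBesselOp ν β u ∧
          T₁ hu.toL2 =ᵐ[volume.restrict (Ioi (0 : ℝ))] eulerOp (scaledBesselOp ν β u) ∧
          T₂ hu.toL2 =ᵐ[volume.restrict (Ioi (0 : ℝ))]
            eulerOp (eulerOp (scaledBesselOp ν β u))) ∧
        ‖T₀‖ ≤ C * (ν ^ 2 - 9 / 4)⁻¹ ∧
        ‖T₁‖ ≤ C * (ν - 3 / 2)⁻¹ ∧
        ‖T₂‖ ≤ C := by
  -- The bound on `T₂` dictates the constant: its five terms below add up to at most `4·(4/5) + 9 +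
  -- 1 + 8/5 + 1 = 15.8`.
  refine ⟨17, by norm_num, fun ν β hνδ hβ => ?_⟩
  have hν : 3 / 2 < ν := by linarith
  have hν1 : 1 < ν := by linarith
  obtain ⟨φ, ψ, φ', ψ', h, hφ, hψ⟩ := exists_besselPair hν1 hβ
  obtain ⟨T₀, hT₀, hT₀u⟩ := h.exists_clm_green hν1
  obtain ⟨D, hD, hDu⟩ := h.exists_clm_green_deriv hν1
  obtain ⟨B, hB, hBu⟩ := h.exists_clm_sq_mul_green hν1
  have hker : ∀ x y, 0 < x → 0 < y → besselKernel ν β x y = greenKernel φ ψ ψ φ x y :=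
    fun x y hx hy => besselKernel_eq_greenKernel hφ hψ hx hy
  have hop : ∀ (u : ℝ → ℂ) (x : ℝ), 0 < x →
      besselOp ν β u x = ∫ y in Ioi (0 : ℝ), (greenKernel φ ψ ψ φ x y : ℂ) * u y :=
    fun u x hx => setIntegral_congr_fun measurableSet_Ioi fun y hy => by
      simp only [hker x y hx hy]
  -- classical derivatives on test functions
  let f₀ : (ℝ → ℂ) → ℝ → ℂ := fun u x => ((x ^ 2 : ℝ) : ℂ)⁻¹ * greenSolution φ ψ ψ φ u x
  let f₁ : (ℝ → ℂ) → ℝ → ℂ := fun u x =>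
    -2 * f₀ u x + (x : ℂ)⁻¹ * greenSolution φ ψ ψ' φ' u x
  -- This is `x f₁'` with `(Ku)''` replaced by `V Ku - u`, so only operators already bounded occur.
  let f₂ : (ℝ → ℂ) → ℝ → ℂ := fun u x => 4 * f₀ u x
    - 3 * ((x : ℂ)⁻¹ * greenSolution φ ψ ψ' φ' u x)
    + (β : ℂ) ^ 2 * greenSolution φ ψ ψ φ u x + ((ν ^ 2 - 1 / 4 : ℝ) : ℂ) * f₀ u x - u x
  have hxC : ∀ x : ℝ, 0 < x → (x : ℂ) ≠ 0 := fun x hx => Complex.ofReal_ne_zero.2 hx.ne'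
  have d₀ : ∀ u, IsTestFunction u → ∀ x : ℝ, 0 < x →
      HasDerivAt (f₀ u) ((x : ℂ)⁻¹ * f₁ u x) x := fun u hu x hx => by
    have hx0 := hxC x hx
    have e := ((hasDerivAt_pow 2 x).ofReal_comp.inv
      (by exact_mod_cast pow_ne_zero 2 hx.ne')).mul (h.hasDerivAt_solution hu hx)
    refine e.congr_deriv ?_
    simp only [f₁, f₀, Pi.inv_apply]
    push_cast
    field_simp
  have d₁ : ∀ u, IsTestFunction u → ∀ x : ℝ, 0 < x →
      HasDerivAt (f₁ u) ((x : ℂ)⁻¹ * f₂ u x) x := fun u hu x hx => by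
    have hx0 := hxC x hx
    have e := ((d₀ u hu x hx).const_mul (-2)).add
      (((hasDerivAt_id x).ofReal_comp.inv hx0).mul (h.hasDerivAt_solution' hu hx))
    refine e.congr_deriv ?_
    simp only [f₂, f₁, f₀, besselPotential, id, Pi.inv_apply]
    push_cast
    field_simp
    ring
  have c₀ : ∀ u, IsTestFunction u → ContinuousOn (f₀ u) (Ioi 0) := fun u hu x hx =>
    (d₀ u hu x hx).continuousAt.continuousWithinAt
  have c₁ : ∀ u, IsTestFunction u → ContinuousOn (f₁ u) (Ioi 0) := fun u hu x hx =>
    (d₁ u hu x hx).continuousAt.continuousWithinAt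
  have cinv : ContinuousOn (fun x : ℝ => (x : ℂ)⁻¹) (Ioi 0) :=
    Complex.continuous_ofReal.continuousOn.inv₀ hxC
  have cv : ∀ u, IsTestFunction u → ContinuousOn (greenSolution φ ψ ψ φ u) (Ioi 0) :=
    fun u hu x hx => (h.hasDerivAt_solution hu hx).continuousAt.continuousWithinAt
  have cv' : ∀ u, IsTestFunction u → ContinuousOn (greenSolution φ ψ ψ' φ' u) (Ioi 0) :=
    fun u hu x hx => (h.hasDerivAt_solution' hu hx).continuousAt.continuousWithinAt
  have c₂ : ∀ u, IsTestFunction u → ContinuousOn (f₂ u) (Ioi 0) := fun u hu =>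
    ((((continuousOn_const.mul (c₀ u hu)).sub (continuousOn_const.mul (cinv.mul (cv' u hu)))).add
      (continuousOn_const.mul (cv u hu))).add (continuousOn_const.mul (c₀ u hu))).sub
      hu.smooth.continuous.continuousOn
  -- identification of the operators on test functions
  have hint : ∀ (u : ℝ → ℂ) (hu : IsTestFunction u) (p q : ℝ → ℝ) (x : ℝ), 0 < x →
      ∫ y in Ioi (0 : ℝ), (greenKernel φ ψ p q x y : ℂ) * hu.toL2 y
        = greenSolution φ ψ p q u x := fun u hu p q x hx => by
    rw [← integral_greenKernel_mul hx h.continuousOn_left h.continuousOn_right hu]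
    refine integral_congr_ae ?_
    filter_upwards [hu.memLp.coeFn_toLp] with y hy
    rw [IsTestFunction.toL2, hy]
  have t₀ : ∀ (u : ℝ → ℂ) (hu : IsTestFunction u),
      T₀ hu.toL2 =ᵐ[volume.restrict (Ioi (0 : ℝ))] f₀ u := fun u hu => by
    filter_upwards [hT₀u hu.toL2, ae_restrict_mem measurableSet_Ioi] with x hx hx0
    rw [hx, hint u hu _ _ x hx0]
  -- Defining the operators by the formulas for `f₁` and `f₂` makes boundedness immediate; that they
  -- are weak derivatives is proved afterwards.
  let T₁ : L2Half →L[ℂ] L2Half := (-2 : ℂ) • T₀ + D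
  let T₂ : L2Half →L[ℂ] L2Half := (4 : ℂ) • T₀ - (3 : ℂ) • D + B
    + ((ν ^ 2 - 1 / 4 : ℝ) : ℂ) • T₀ - ContinuousLinearMap.id ℂ L2Half
  have t₁ : ∀ (u : ℝ → ℂ) (hu : IsTestFunction u),
      T₁ hu.toL2 =ᵐ[volume.restrict (Ioi (0 : ℝ))] f₁ u := fun u hu => by
    filter_upwards [t₀ u hu, hDu hu.toL2, Lp.coeFn_add ((-2 : ℂ) • T₀ hu.toL2) (D hu.toL2),
      Lp.coeFn_smul (-2 : ℂ) (T₀ hu.toL2), ae_restrict_mem measurableSet_Ioi]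
      with x h1 h2 h3 h4 hx
    change ((-2 : ℂ) • T₀ hu.toL2 + D hu.toL2 : L2Half) x = _
    rw [h3, Pi.add_apply, h4, Pi.smul_apply, h1, h2, hint u hu _ _ x hx, smul_eq_mul]
  have t₂ : ∀ (u : ℝ → ℂ) (hu : IsTestFunction u),
      T₂ hu.toL2 =ᵐ[volume.restrict (Ioi (0 : ℝ))] f₂ u := fun u hu => by
    set U := hu.toL2 with hU
    filter_upwards [t₀ u hu, hDu U, hBu U, hu.memLp.coeFn_toLp,
      Lp.coeFn_sub ((4 : ℂ) • T₀ U - (3 : ℂ) • D U + B U + ((ν ^ 2 - 1 / 4 : ℝ) : ℂ) • T₀ U) U,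
      Lp.coeFn_add ((4 : ℂ) • T₀ U - (3 : ℂ) • D U + B U) (((ν ^ 2 - 1 / 4 : ℝ) : ℂ) • T₀ U),
      Lp.coeFn_add ((4 : ℂ) • T₀ U - (3 : ℂ) • D U) (B U),
      Lp.coeFn_sub ((4 : ℂ) • T₀ U) ((3 : ℂ) • D U),
      Lp.coeFn_smul (4 : ℂ) (T₀ U), Lp.coeFn_smul (3 : ℂ) (D U),
      Lp.coeFn_smul ((ν ^ 2 - 1 / 4 : ℝ) : ℂ) (T₀ U), ae_restrict_mem measurableSet_Ioi]
      with x h0 hD hB hid h1 h2 h3 h4 h5 h6 h7 hx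
    change ((4 : ℂ) • T₀ U - (3 : ℂ) • D U + B U + ((ν ^ 2 - 1 / 4 : ℝ) : ℂ) • T₀ U - U :
      L2Half) x = _
    rw [h1, Pi.sub_apply, h2, Pi.add_apply, h3, Pi.add_apply, h4, Pi.sub_apply, h5, h6, h7]
    simp only [Pi.smul_apply, smul_eq_mul]
    rw [h0, hD, hB, hint u hu _ _ x hx, hint u hu _ _ x hx, hU, IsTestFunction.toL2, hid]
  have hscaled : ∀ u, IsTestFunction u → ∀ x, 0 < x → scaledBesselOp ν β u x = f₀ u x :=
    fun u hu x hx => by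
      rw [scaledBesselOp, hop u x hx,
        integral_greenKernel_mul hx h.continuousOn_left h.continuousOn_right hu]
  have heuler₁ : ∀ u, IsTestFunction u → ∀ x, 0 < x →
      eulerOp (scaledBesselOp ν β u) x = f₁ u x := fun u hu x hx => by
    rw [eulerOp_congr (hscaled u hu) hx, eulerOp, (d₀ u hu x hx).deriv,
      mul_inv_cancel_left₀ (hxC x hx)]
  have heuler₂ : ∀ u, IsTestFunction u → ∀ x, 0 < x →
      eulerOp (eulerOp (scaledBesselOp ν β u)) x = f₂ u x := fun u hu x hx => by
    rw [eulerOp_congr (heuler₁ u hu) hx, eulerOp, (d₁ u hu x hx).deriv,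
      mul_inv_cancel_left₀ (hxC x hx)]
  -- norms
  have hn1 : 0 < ν - 3 / 2 := by linarith
  have hn2 : 0 < ν - 1 := by linarith
  set d : ℝ := 1 / (ν + 1) + 1 / (ν - 1) with hd
  have hd0 : 0 < d := by positivity
  have hd1 : d ≤ 2 * (ν - 3 / 2)⁻¹ := by
    have h1 : 1 / (ν + 1) ≤ 1 / (ν - 3 / 2) := one_div_le_one_div_of_le hn1 (by linarith)
    have h2 : 1 / (ν - 1) ≤ 1 / (ν - 3 / 2) := one_div_le_one_div_of_le hn1 (by linarith)
    rw [← one_div]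
    linarith
  have hd2 : d ≤ 3 := by
    have h1 : 1 / (ν + 1) ≤ 1 / 1 := one_div_le_one_div_of_le one_pos (by linarith)
    have h2 : 1 / (ν - 1) ≤ 1 / (1 / 2) := one_div_le_one_div_of_le (by norm_num) (by linarith)
    norm_num at h1 h2
    rw [hd, one_div, one_div]
    linarith
  have ha : 1 / (2 * ν) * d = (ν ^ 2 - 1)⁻¹ := by
    have : ν ^ 2 - 1 = (ν + 1) * (ν - 1) := by ring
    rw [hd, this]
    field_simp
    ring
  have hq : 5 / 4 ≤ ν ^ 2 - 1 := by nlinarith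
  have hνd : 1 / (2 * ν) * d ≤ d := by
    have : 1 / (2 * ν) ≤ 1 := (div_le_one (by linarith)).2 (by linarith)
    exact mul_le_of_le_one_left hd0.le this
  refine ⟨T₀, T₁, T₂, fun u => ⟨fun x hx => ?_, ?_⟩, fun u => ⟨?_, ?_⟩, fun u hu => ⟨?_, ?_, ?_, ?_⟩,
    ?_, ?_, ?_⟩
  · have hI : IntegrableOn (fun y => (greenKernel φ ψ ψ φ x y : ℂ) * u y) (Ioi 0) :=
      (h.memLp_green hν1 hx).integrable_mul (Lp.memLp u)
    exact hI.congr_fun (fun y hy => by simp only [hker x y hx hy]) measurableSet_Ioi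
  · filter_upwards [hT₀u u, ae_restrict_mem measurableSet_Ioi] with x hx hx0
    rw [hx, scaledBesselOp, hop u x hx0]
  · refine isWeakEuler_of_testFunctions (fun u hu => ⟨f₀ u, fun x => (x : ℂ)⁻¹ * f₁ u x,
      d₀ u hu, cinv.mul (c₁ u hu), t₀ u hu, ?_⟩) u
    filter_upwards [t₁ u hu, ae_restrict_mem measurableSet_Ioi] with x hx hx0
    rw [hx, mul_inv_cancel_left₀ (hxC x hx0)]
  · refine isWeakEuler_of_testFunctions (fun u hu => ⟨f₁ u, fun x => (x : ℂ)⁻¹ * f₂ u x,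
      d₁ u hu, cinv.mul (c₂ u hu), t₁ u hu, ?_⟩) u
    filter_upwards [t₂ u hu, ae_restrict_mem measurableSet_Ioi] with x hx hx0
    rw [hx, mul_inv_cancel_left₀ (hxC x hx0)]
  · refine (contDiffOn_two_of_hasDerivAt isOpen_Ioi (fun x hx => h.hasDerivAt_solution hu hx)
      (fun x hx => h.hasDerivAt_solution' hu hx) ?_).congr fun x hx => ?_
    · exact ((Complex.continuous_ofReal.comp_continuousOn
        (BesselPair.continuousOn_potential ν β)).mul (cv u hu)).sub
        hu.smooth.continuous.continuousOn
    · rw [hop u x hx, integral_greenKernel_mul hx h.continuousOn_left h.continuousOn_right hu]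
  · filter_upwards [t₀ u hu, ae_restrict_mem measurableSet_Ioi] with x hx hx0
    rw [hx, hscaled u hu x hx0]
  · filter_upwards [t₁ u hu, ae_restrict_mem measurableSet_Ioi] with x hx hx0
    rw [hx, heuler₁ u hu x hx0]
  · filter_upwards [t₂ u hu, ae_restrict_mem measurableSet_Ioi] with x hx hx0
    rw [hx, heuler₂ u hu x hx0]
  · have h1 : (ν ^ 2 - 1)⁻¹ ≤ (ν ^ 2 - 9 / 4)⁻¹ := inv_anti₀ (by nlinarith) (by linarith)
    have h2 : 0 < (ν ^ 2 - 9 / 4)⁻¹ := inv_pos.2 (by nlinarith)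
    linarith
  · calc ‖T₁‖ ≤ ‖(-2 : ℂ) • T₀‖ + ‖D‖ := norm_add_le _ _
      _ ≤ 2 * d + d := by
        rw [norm_smul, norm_neg, Complex.norm_ofNat]
        linarith
      _ ≤ 17 * (ν - 3 / 2)⁻¹ := by
        have := inv_pos.2 hn1
        linarith
  · have e1 : ‖(4 : ℂ) • T₀‖ ≤ 4 * (ν ^ 2 - 1)⁻¹ := by
      rw [norm_smul, Complex.norm_ofNat]
      linarith
    have e2 : ‖(3 : ℂ) • D‖ ≤ 9 := by
      rw [norm_smul, Complex.norm_ofNat]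
      linarith
    -- The coefficient grows like `ν²`, but `‖T₀‖ ≤ (ν² - 1)⁻¹` compensates it exactly, keeping the
    -- product bounded uniformly in `ν`.
    have e3 : ‖((ν ^ 2 - 1 / 4 : ℝ) : ℂ) • T₀‖ ≤ (ν ^ 2 - 1 / 4) * (ν ^ 2 - 1)⁻¹ := by
      rw [norm_smul, Complex.norm_real, Real.norm_of_nonneg (by linarith)]
      gcongr
      · linarith
      · linarith
    have e4 : ‖ContinuousLinearMap.id ℂ L2Half‖ ≤ 1 := ContinuousLinearMap.norm_id_le
    have e5 : (ν ^ 2 - 1)⁻¹ ≤ 4 / 5 := by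
      rw [show (4 / 5 : ℝ) = (5 / 4)⁻¹ by norm_num]
      exact inv_anti₀ (by norm_num) hq
    have e6 : (ν ^ 2 - 1 / 4) * (ν ^ 2 - 1)⁻¹ = 1 + 3 / 4 * (ν ^ 2 - 1)⁻¹ := by
      have : ν ^ 2 - 1 ≠ 0 := by linarith
      field_simp
      ring
    have n1 := norm_sub_le ((4 : ℂ) • T₀ - (3 : ℂ) • D + B + ((ν ^ 2 - 1 / 4 : ℝ) : ℂ) • T₀)
      (ContinuousLinearMap.id ℂ L2Half)
    have n2 := norm_add_le ((4 : ℂ) • T₀ - (3 : ℂ) • D + B) (((ν ^ 2 - 1 / 4 : ℝ) : ℂ) • T₀)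
    have n3 := norm_add_le ((4 : ℂ) • T₀ - (3 : ℂ) • D) B
    have n4 := norm_sub_le ((4 : ℂ) • T₀) ((3 : ℂ) • D)
    have n0 : ‖T₂‖ = ‖(4 : ℂ) • T₀ - (3 : ℂ) • D + B + ((ν ^ 2 - 1 / 4 : ℝ) : ℂ) • T₀
      - ContinuousLinearMap.id ℂ L2Half‖ := rfl
    linarith
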